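/- Notation. Inequalities between vectors of $\mathbb{R}^2$, and absolute values and logarithms of vectors, are componentwise. Let $\mathbb{T}^2=\{z\in\mathbb{C}^2:|z_1|=|z_2|=1\}$ and let $m$ be its normalised Lebesgue measure. For $\ell\in\{1,-1\}$ let $\Sigma^\ell=\{\sigma\in\{\pm1\}^2:\sigma_1\sigma_2=\ell\}$. For $P\in\mathrm{GL}_2(\mathbb{R})$, $\delta\in\mathbb{R}^2$ and $\sigma\in\{\pm1\}^2$ put $$\Lambda^\sigma_{P,\delta}=P\{y\in\mathbb{R}^2:\sigma_1y_1>\delta_1,\ \sigma_2y_2>\delta_2\},\qquad D^\sigma_{P,\delta}=\{z\in(\mathbb{C}\setminus\{0\})^2:\log|z|\in\Lambda^\sigma_{P,\delta}\},$$ $$\mathbb{T}^\sigma_{P,\delta}=\{z\in\mathbb{C}^2: |z|=e^{v}\},\quad v=P(\sigma_1\delta_1,\sigma_2\delta_2)^T,\qquad \mathcal{A}_{P,\delta}=\{z\in(\mathbb{C}\setminus\{0\})^2:-|\delta|<P^{-1}\log|z|<|\delta|\}.$$ For $\rho\in\mathbb{R}^2_{>0}$ let $\mathbb{T}^2_\rho=\{z\in\mathbb{C}^2:|z|=\rho\}$.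 For $\delta,\Delta\in\mathbb{R}^2_{>0}$, a map that is holomorphic, with values in $\mathbb{C}^2$, on a neighbourhood of $\overline{\mathcal{A}_{P,\delta}}$ is called $(\ell,\delta,\Delta,P)$-strongly expanding if either (EP) it maps $\mathbb{T}^\sigma_{P,\delta}$ into $D^\sigma_{P,\Delta}$ and $\overline{\Lambda^\sigma_{P,\Delta}}\subset\Lambda^\sigma_{P,\delta}$ for all $\sigma\in\Sigma^\ell$, or (ER) it maps $\mathbb{T}^\sigma_{P,\delta}$ into $D^{-\sigma}_{P,\Delta}$ and $\overline{\Lambda^{-\sigma}_{P,\Delta}}\subset\Lambda^{-\sigma}_{P,\delta}$ for all $\sigma\in\Sigma^\ell$. For $\alpha,\beta\in\mathbb{R}^2$ let $H_{P,\alpha,\beta}$ be the Hilbert space completion of the space of Laurent polynomials $f=\sum_{n\in\mathbb{Z}^2} f_nz^n$ with respect to the norm $\|f\|_\nu=(\sum_n|f_n|^2\nu(n)^2)^{1/2}$, where $\nu(n)=\exp(-a_1|k_1|-a_2|k_2|)$ with $k=P^Tn$, and $a=\alpha$ if $k_1k_2\ge0$, $a=\beta$ if $k_1k_2<0$. A function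 $g$ on $\mathbb{T}^2$ is identified with $h\in H_{P,\alpha,\beta}$ if its Fourier series $\sum_n\hat g(n)z^n$, $\hat g(n)=\int_{\mathbb{T}^2} g(z)z^{-n}\,dm(z)$, converges (unconditionally) to $h$ in $H_{P,\alpha,\beta}$. Theorem. Let $T$ be an analytic diffeomorphism of $\mathbb{T}^2$. Assume that there are $\alpha,\gamma,A,\Gamma,\eta\in\mathbb{R}^2_{>0}$ with $\alpha,\gamma<\eta$, and $P\in\mathrm{GL}_2(\mathbb{R})$, such that $T$ and $T^{-1}$ extend to holomorphic maps $\mathcal{A}_{P,\eta}\to\mathbb{C}^2$ (again denoted by $T$ and $T^{-1}$), and such that (i) $T$ is $(1,\alpha,A,P)$-strongly expanding; (ii) $T^{-1}$ is $(-1,\Gamma,\gamma,P)$-strongly expanding; (iii) for all $\tilde\sigma\in\Sigma^1$ and $\sigma\in\Sigma^{-1}$ there is $\rho\in\mathbb{R}^2_{>0}$ with $\mathbb{T}^2_\rho\subset D^\sigma_{P,\gamma}\cap\mathcal{A}_{P,\eta}$ and $T(\mathbb{T}^2_\rho)\subset D^{\tilde\sigma}_{P,A}$. Then the composition operator $C_T\colon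 f\mapsto f\circ T$ maps $H_{P,A,-\Gamma}$ continuously to $H_{P,\alpha,-\gamma}$: there is exactly one continuous linear operator $H_{P,A,-\Gamma}\to H_{P,\alpha,-\gamma}$ that sends every Laurent polynomial $f$ to $f\circ T$. -/

import Mathlib

open scoped ComplexConjugate

noncomputable section

namespace TorusHardy

/-! ### Quadrants, cones, Reinhardt domains and annuli -/

/-- The two sign vectors `σ = (σ₁, σ₂) ∈ {±1}²` with `σ₁ σ₂ = ℓ`, where `ℓ = 1` or `ℓ = -1`. -/
def signs (l : ℤˣ) : Set (Fin 2 → ℤˣ) := {σ | σ 0 * σ 1 = l}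

/-- The sign `±1` as a real number. -/
def sgn (s : ℤˣ) : ℝ := ((s : ℤ) : ℝ)

/-- The affine cone `Λ = P (I^σ (ℝ²_{>0} + δ))`: the image under `P` of the translated quadrant
`{y | σ₁ y₁ > δ₁, σ₂ y₂ > δ₂}`. -/
def cone (P : Matrix.GeneralLinearGroup (Fin 2) ℝ) (δ : Fin 2 → ℝ) (σ : Fin 2 → ℤˣ) :
    Set (Fin 2 → ℝ) :=
  (fun y => P.1.mulVec y) '' {y | ∀ i, δ i < sgn (σ i) * y i}

/-- The apex `v = P (I^σ δ)` of that cone. -/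
def apex (P : Matrix.GeneralLinearGroup (Fin 2) ℝ) (δ : Fin 2 → ℝ) (σ : Fin 2 → ℤˣ) :
    Fin 2 → ℝ :=
  P.1.mulVec fun i => sgn (σ i) * δ i

/-- `log |z| = (log |z₁|, log |z₂|)`; only used for `z` with nonzero coordinates. -/
def logAbs (z : Fin 2 → ℂ) : Fin 2 → ℝ := fun i => Real.log ‖z i‖

/-- The log-conical Reinhardt domain with logarithmic base `cone P δ σ`, as a subset of
`(ℂ \ {0})²`. -/
def domain (P : Matrix.GeneralLinearGroup (Fin 2) ℝ) (δ : Fin 2 → ℝ) (σ : Fin 2 → ℤˣ) :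
    Set (Fin 2 → ℂ) :=
  {z | (∀ i, z i ≠ 0) ∧ logAbs z ∈ cone P δ σ}

/-- The torus `{z ∈ ℂ² | |z₁| = ρ₁, |z₂| = ρ₂}`. -/
def polyTorus (ρ : Fin 2 → ℝ) : Set (Fin 2 → ℂ) := {z | ∀ i, ‖z i‖ = ρ i}

/-- The distinguished boundary of `domain P δ σ`. -/
def shilovTorus (P : Matrix.GeneralLinearGroup (Fin 2) ℝ) (δ : Fin 2 → ℝ) (σ : Fin 2 → ℤˣ) :
    Set (Fin 2 → ℂ) :=
  polyTorus fun i => Real.exp (apex P δ σ i)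

/-- The annulus `{z | -|δ| < P⁻¹ log |z| < |δ|}`, a neighbourhood of the unit torus. -/
def annulus (P : Matrix.GeneralLinearGroup (Fin 2) ℝ) (δ : Fin 2 → ℝ) : Set (Fin 2 → ℂ) :=
  {z | (∀ i, z i ≠ 0) ∧ ∀ i, |(P⁻¹).1.mulVec (logAbs z) i| < |δ i|}

/-! ### Maps of the torus -/

/-- A point of the unit torus `𝕋²` as a point of `ℂ²`. -/
def toC2 (z : Fin 2 → Circle) : Fin 2 → ℂ := fun i => (z i : ℂ)

/-- `F` is a holomorphic extension to `U` of the self-map `T` of the unit torus. -/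
def IsHolomorphicExtension (T : (Fin 2 → Circle) → (Fin 2 → Circle))
    (F : (Fin 2 → ℂ) → (Fin 2 → ℂ)) (U : Set (Fin 2 → ℂ)) : Prop :=
  DifferentiableOn ℂ F U ∧ ∀ z, F (toC2 z) = toC2 (T z)

/-- The `(ℓ, δ, Δ, P)`-strongly expanding mapping property of a map `F` which is holomorphic near
the closure of the annulus of width `δ`: the distinguished boundaries of width `δ` are mapped into
the domains of width `Δ` with the same sign vector (first alternative), or with the opposite sign
vector (second alternative), and the latter domains are relatively compact in those of width `δ`.
Relative compactness of log-conical domains is expressed through their logarithmic bases. -/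
def StronglyExpanding (l : ℤˣ) (δ Δ : Fin 2 → ℝ) (P : Matrix.GeneralLinearGroup (Fin 2) ℝ)
    (F : (Fin 2 → ℂ) → (Fin 2 → ℂ)) : Prop :=
  (∃ U : Set (Fin 2 → ℂ), IsOpen U ∧ closure (annulus P δ) ⊆ U ∧ DifferentiableOn ℂ F U) ∧
  ((∀ σ ∈ signs l, Set.MapsTo F (shilovTorus P δ σ) (domain P Δ σ) ∧
      closure (cone P Δ σ) ⊆ cone P δ σ) ∨
   (∀ σ ∈ signs l, Set.MapsTo F (shilovTorus P δ σ) (domain P Δ (-σ)) ∧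
      closure (cone P Δ (-σ)) ⊆ cone P δ (-σ)))

/-! ### Laurent polynomials with a weighted norm, and their completion -/

/-- Laurent polynomials `∑ fₙ zⁿ`, `n ∈ ℤ²`, given by their coefficients. The parameter `ν` is the
weight of the norm that this space carries. -/
def Laurent (_ν : (Fin 2 → ℤ) → {x : ℝ // 0 < x}) : Type := (Fin 2 → ℤ) →₀ ℂ

variable (ν : (Fin 2 → ℤ) → {x : ℝ // 0 < x})

instance : AddCommGroup (Laurent ν) := inferInstanceAs (AddCommGroup ((Fin 2 → ℤ) →₀ ℂ))

instance : Module ℂ (Laurent ν) := inferInstanceAs (Module ℂ ((Fin 2 → ℤ) →₀ ℂ))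

/-- The coefficient of `zⁿ`. -/
def Laurent.coeff {ν : (Fin 2 → ℤ) → {x : ℝ // 0 < x}} (f : Laurent ν) (n : Fin 2 → ℤ) : ℂ :=
  (show (Fin 2 → ℤ) →₀ ℂ from f) n

theorem Laurent.finite_support {ν : (Fin 2 → ℤ) → {x : ℝ // 0 < x}} (f : Laurent ν) :
    (Function.support f.coeff).Finite :=
  Finsupp.hasFiniteSupport (show (Fin 2 → ℤ) →₀ ℂ from f)

/-- The weighted inner product `∑ₙ conj(fₙ) gₙ ν(n)²` (conjugate linear in the first argument). -/
def weightedInner (f g : Laurent ν) : ℂ :=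
  ∑ᶠ n, conj (f.coeff n) * g.coeff n * ((((ν n : ℝ) ^ 2 : ℝ)) : ℂ)

theorem weightedInner_eq_sum (f g : Laurent ν) (s : Finset (Fin 2 → ℤ))
    (hs : Function.support f.coeff ⊆ s) :
    weightedInner ν f g =
      ∑ n ∈ s, conj (f.coeff n) * g.coeff n * ((((ν n : ℝ) ^ 2 : ℝ)) : ℂ) := by
  refine finsum_eq_sum_of_support_subset _ fun n hn => hs ?_
  simp only [Function.mem_support] at hn ⊢
  intro h
  exact hn (by simp [h])

theorem weightedInner_self (f : Laurent ν) :
    weightedInner ν f f =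
      ((∑ n ∈ f.finite_support.toFinset, ‖f.coeff n‖ ^ 2 * (ν n : ℝ) ^ 2 : ℝ) : ℂ) := by
  rw [weightedInner_eq_sum ν f f f.finite_support.toFinset (by simp)]
  push_cast
  refine Finset.sum_congr rfl fun n _ => ?_
  rw [Complex.conj_mul']

/-- The weighted inner product is an inner product. -/
@[reducible]
def laurentCore : InnerProductSpace.Core ℂ (Laurent ν) where
  inner := weightedInner ν
  conj_inner_symm f g := by
    classical
    rw [weightedInner_eq_sum ν f g (f.finite_support.toFinset ∪ g.finite_support.toFinset)
        (by simp),
      weightedInner_eq_sum ν g f (f.finite_support.toFinset ∪ g.finite_support.toFinset)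
        (by simp), map_sum]
    refine Finset.sum_congr rfl fun n _ => ?_
    rw [map_mul, map_mul, Complex.conj_conj, Complex.conj_ofReal]
    ring
  re_inner_nonneg f := by
    rw [weightedInner_self]
    exact Finset.sum_nonneg fun n _ => by positivity
  add_left f g h := by
    classical
    let s := f.finite_support.toFinset ∪ g.finite_support.toFinset
    have hc : ∀ n, (f + g).coeff n = f.coeff n + g.coeff n := fun n => rfl
    rw [weightedInner_eq_sum ν (f + g) h s, weightedInner_eq_sum ν f h s (by simp [s]),
      weightedInner_eq_sum ν g h s (by simp [s]), ← Finset.sum_add_distrib]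
    · refine Finset.sum_congr rfl fun n _ => ?_
      rw [hc, map_add]
      ring
    · intro n hn
      by_contra hns
      simp only [s, Finset.coe_union, Set.Finite.coe_toFinset, Set.mem_union,
        Function.mem_support, not_or, not_not] at hns
      exact hn (by rw [hc, hns.1, hns.2, add_zero])
  smul_left f g r := by
    have hc : ∀ n, (r • f).coeff n = r * f.coeff n := fun n => rfl
    rw [weightedInner_eq_sum ν (r • f) g f.finite_support.toFinset,
      weightedInner_eq_sum ν f g f.finite_support.toFinset (by simp), Finset.mul_sum]
    · refine Finset.sum_congr rfl fun n _ => ?_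
      rw [hc, map_mul]
      ring
    · intro n hn
      simp only [Set.Finite.coe_toFinset, Function.mem_support]
      intro h
      exact hn (by rw [hc, h, mul_zero])
  definite f hf := by
    rw [weightedInner_self, Complex.ofReal_eq_zero,
      Finset.sum_eq_zero_iff_of_nonneg fun n _ => by positivity] at hf
    refine Finsupp.ext fun n => ?_
    by_contra hn
    have hn' : f.coeff n ≠ 0 := hn
    have h := hf n (by simpa using hn')
    have hν := (ν n).2
    have hp : 0 < ‖f.coeff n‖ := norm_pos_iff.mpr hn'
    exact (mul_pos (pow_pos hp 2) (pow_pos hν 2)).ne' h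

instance : NormedAddCommGroup (Laurent ν) := (laurentCore ν).toNormedAddCommGroup

instance : InnerProductSpace ℂ (Laurent ν) := InnerProductSpace.ofCore (laurentCore ν).toCore

/-- The Hilbert space `H_ν`: the completion of the Laurent polynomials in the norm `‖·‖_ν`. -/
abbrev HardySpace : Type := UniformSpace.Completion (Laurent ν)

/-- The monomial `zⁿ` as a Laurent polynomial. -/
def monomial (n : Fin 2 → ℤ) : Laurent ν :=
  show (Fin 2 → ℤ) →₀ ℂ from Finsupp.single n 1

/-- The function on the unit torus `z ↦ ∑ fₙ zⁿ` given by a Laurent polynomial. -/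
def Laurent.toFun {ν : (Fin 2 → ℤ) → {x : ℝ // 0 < x}} (f : Laurent ν) (z : Fin 2 → Circle) : ℂ :=
  ∑ᶠ n : Fin 2 → ℤ, f.coeff n * ∏ i, (z i : ℂ) ^ n i

/-- The `n`-th Fourier coefficient `∫ g(z) z⁻ⁿ dm(z)` of a function `g` on the unit torus, where
`m` is the normalised Lebesgue measure. -/
def fourierCoefficient (g : (Fin 2 → Circle) → ℂ) (n : Fin 2 → ℤ) : ℂ :=
  UnitAddTorus.mFourierCoeff (fun x : UnitAddTorus (Fin 2) => g fun i => (x i).toCircle) n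

/-- `Represents g h`: the element `h` of `H_ν` is the function `g` on the unit torus, that is, the
Fourier series of `g` converges to `h` in `H_ν`. -/
def Represents {ν : (Fin 2 → ℤ) → {x : ℝ // 0 < x}} (g : (Fin 2 → Circle) → ℂ)
    (h : HardySpace ν) : Prop :=
  HasSum (fun n => fourierCoefficient g n • ((monomial ν n : Laurent ν) : HardySpace ν)) h

/-- The cone-wise exponential weight `ν(n) = exp(-⟨a(m), |m|⟩)` with `m = Pᵀ n`, where `a(m) = α`
if `m₁ m₂ ≥ 0` and `a(m) = β` if `m₁ m₂ < 0`. -/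
def coneWeight (P : Matrix.GeneralLinearGroup (Fin 2) ℝ) (α β : Fin 2 → ℝ) (n : Fin 2 → ℤ) :
    {x : ℝ // 0 < x} :=
  let m : Fin 2 → ℝ := P.1.transpose.mulVec fun i => (n i : ℝ)
  ⟨Real.exp (-∑ i, (if 0 ≤ m 0 * m 1 then α i else β i) * |m i|), Real.exp_pos _⟩

end TorusHardy

end

/-!
In the basis of monomials the operator `C_T` is the infinite matrix whose `m`-th row is the Laurent
expansion of `T ^ m` on the unit torus. Rows and columns are split according to the quadrant in
which `k = Pᵀ n` lies. Two estimates control each block.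

* If `h` is holomorphic near the tori `{|z| = exp (t v)}`, `0 ≤ t ≤ 1`, then its Laurent
  coefficients satisfy Bessel's inequality with weights `exp ⟨n, v⟩` in terms of the supremum of `h`
  on `{|z| = exp v}`.
* If `f` has exponents in the quadrant `-τ`, then Cauchy–Schwarz bounds `f` on compact subsets of
  `D^τ_A` by its norm with weights `exp (-⟨A, |k|⟩)`.

Applied to `f ∘ T` they bound the blocks with `m` in `k₁ k₂ ≥ 0`, using the tori `𝕋^σ_α` when `n` is
of the same type and those of (iii) otherwise. The blocks with `m` in `k₁ k₂ < 0` come from the unit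
torus and, when `n` is of that type too, from the transposed matrix: the substitution `z = T⁻¹ w`
turns it into the Laurent coefficients of `(T⁻¹) ^ (-n)` times a density. Up to a constant sign the
density is the determinant of the Jacobian matrix of `T⁻¹` in logarithmic coordinates, so it is
holomorphic wherever `T⁻¹` is holomorphic with nonvanishing components. By Schwarz reflection the
components of `T` and `T⁻¹` have no zeros on the tori between the unit torus and the one used.
-/

noncomputable section

namespace TorusHardy

open scoped ComplexConjugate Topology
open MeasureTheory Set Filter Metric

section HolomorphicParameters

theorem mapsTo_closedBall_two_mul {E G : Type*} [PseudoMetricSpace E]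
    [SeminormedAddCommGroup G] {f : E → G} {x : E} {r M : ℝ}
    (hM : ∀ y ∈ closedBall x r, ‖f y‖ ≤ M) :
    MapsTo f (ball x r) (closedBall (f x) (2 * M)) := by
  intro y hy
  have hx := hM x (mem_closedBall_self (nonempty_ball.1 ⟨y, hy⟩).le)
  rw [mem_closedBall, dist_eq_norm]
  linarith [norm_sub_le (f y) (f x), hM y (ball_subset_closedBall hy)]

variable {E G α : Type*} [NormedAddCommGroup E] [NormedSpace ℂ E] [NormedAddCommGroup G]
  [NormedSpace ℂ G]

theorem fderiv_apply_eq_circleIntegral [CompleteSpace G] {U : Set E} (hU : IsOpen U) {f : E → G}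
    (hf : DifferentiableOn ℂ f U) {y e : E} {R : ℝ} (hR : 0 < R)
    (hmaps : MapsTo (fun ζ : ℂ => y + ζ • e) (closedBall 0 R) U) :
    fderiv ℂ f y e =
      (2 * Real.pi * Complex.I : ℂ)⁻¹ • ∮ ζ in C(0, R), (ζ ^ 2)⁻¹ • f (y + ζ • e) := by
  have hy : y + (0 : ℂ) • e ∈ U := hmaps (mem_closedBall_self hR.le)
  have hline : HasDerivAt (fun ζ : ℂ => y + ζ • e) e 0 := by
    simpa using ((hasDerivAt_id (0 : ℂ)).smul_const e).const_add y
  have hderiv : HasDerivAt (fun ζ : ℂ => f (y + ζ • e)) (fderiv ℂ f y e) 0 := by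
    have h := (hf.differentiableAt (hU.mem_nhds hy)).hasFDerivAt.comp_hasDerivAt 0 hline
    rwa [zero_smul, add_zero] at h
  have hcauchy := (hf.comp (by fun_prop) hmaps).deriv_eq_smul_circleIntegral hR
  rw [← hderiv.deriv, eq_inv_smul_iff₀ Complex.two_pi_I_ne_zero]
  simpa [Function.comp_def] using hcauchy.symm

variable [FiniteDimensional ℂ E] [TopologicalSpace α] {U : Set E} {K : Set α} {h : E → α → G}

theorem continuousOn_fderiv_param (hU : IsOpen U)
    (hc : ContinuousOn (Function.uncurry h) (U ×ˢ K))
    (hd : ∀ k ∈ K, DifferentiableOn ℂ (fun x => h x k) U) {x : E} (hx : x ∈ U) :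
    ContinuousOn (fun k => fderiv ℂ (fun x => h x k) x) K := by
  have : ProperSpace E := FiniteDimensional.proper ℂ E
  obtain ⟨r, hr, hrU⟩ := nhds_basis_closedBall.mem_iff.1 (hU.mem_nhds hx)
  have hc' : ContinuousOn (Function.uncurry fun k y => h y k) (K ×ˢ closedBall x r) :=
    hc.comp continuous_swap.continuousOn fun p hp => ⟨hrU hp.2, hp.1⟩
  intro k₀ hk₀
  refine Metric.tendsto_nhds.2 fun ε hε => ?_
  obtain ⟨v, hv, hvε⟩ := (isCompact_closedBall x r).mem_uniformity_of_prod hc' hk₀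
    (dist_mem_uniformity (show 0 < r * ε / 4 by positivity))
  filter_upwards [hv, self_mem_nhdsWithin] with k hkv hk
  have hsub : DifferentiableOn ℂ (fun y => h y k - h y k₀) (ball x r) :=
    ((hd k hk).sub (hd k₀ hk₀)).mono (ball_subset_closedBall.trans hrU)
  rw [dist_eq_norm, ← fderiv_fun_sub ((hd k hk).differentiableAt (hU.mem_nhds hx))
    ((hd k₀ hk₀).differentiableAt (hU.mem_nhds hx))]
  calc ‖fderiv ℂ (fun y => h y k - h y k₀) x‖ ≤ 2 * (r * ε / 4) / r :=
        Complex.norm_fderiv_le_div_of_mapsTo_ball hsub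
          (mapsTo_closedBall_two_mul fun y hy => by
            rw [← dist_eq_norm]; exact (hvε k hkv y hy).le) hr
    _ < ε := by rw [div_lt_iff₀ hr]; nlinarith

theorem differentiableOn_setIntegral [CompleteSpace G] [SecondCountableTopology α] [T2Space α]
    [MeasurableSpace α] [OpensMeasurableSpace α] (μ : Measure α) [IsFiniteMeasureOnCompacts μ]
    (hU : IsOpen U) (hK : IsCompact K) (hc : ContinuousOn (Function.uncurry h) (U ×ˢ K))
    (hd : ∀ k ∈ K, DifferentiableOn ℂ (fun x => h x k) U) :
    DifferentiableOn ℂ (fun x => ∫ k in K, h x k ∂μ) U := by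
  have : ProperSpace E := FiniteDimensional.proper ℂ E
  intro x hx
  obtain ⟨r, hr, hrU⟩ := nhds_basis_closedBall.mem_iff.1 (hU.mem_nhds hx)
  obtain ⟨M, hM⟩ := ((isCompact_closedBall x r).prod hK).exists_bound_of_continuousOn
    (hc.mono (prod_mono_left hrU))
  have hcK : ∀ y ∈ U, ContinuousOn (h y) K := fun y hy =>
    hc.comp (f := fun k => (y, k)) (by fun_prop) fun k hk => ⟨hy, hk⟩
  have hlip : ∀ k ∈ K, ∀ y ∈ ball x r, ‖h y k - h x k‖ ≤ 2 * M / r * ‖y - x‖ := by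
    intro k hk y hy
    rw [← dist_eq_norm, ← dist_eq_norm]
    exact Complex.dist_le_div_mul_dist_of_mapsTo_ball (f := fun x => h x k)
      ((hd k hk).mono (ball_subset_closedBall.trans hrU))
      (mapsTo_closedBall_two_mul fun z hz => hM (z, k) ⟨hz, hk⟩) hy
  refine (hasFDerivAt_integral_of_dominated_loc_of_lip' (𝕜 := ℂ) (μ := μ.restrict K)
    (F := h) (F' := fun k => fderiv ℂ (fun x => h x k) x) (bound := fun _ => 2 * M / r)
    (ball_mem_nhds x hr) (fun y hy => ?_) ?_ ?_ ?_ ?_ ?_).2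
    |>.differentiableAt.differentiableWithinAt
  · exact (hcK y (hrU (ball_subset_closedBall hy))).aestronglyMeasurable hK.measurableSet
  · exact (hcK x hx).integrableOn_compact hK
  · exact (continuousOn_fderiv_param hU hc hd hx).aestronglyMeasurable hK.measurableSet
  · exact (ae_restrict_iff' hK.measurableSet).2 (.of_forall hlip)
  · exact integrableOn_const hK.measure_lt_top.ne
  · exact (ae_restrict_iff' hK.measurableSet).2 (.of_forall fun k hk =>
      ((hd k hk).differentiableAt (hU.mem_nhds hx)).hasFDerivAt)

theorem differentiableOn_circleIntegral [CompleteSpace G] (hU : IsOpen U) {c : ℂ} {R : ℝ}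
    (hR : 0 ≤ R) {h : E → ℂ → G} (hc : ContinuousOn (Function.uncurry h) (U ×ˢ sphere c R))
    (hd : ∀ ζ ∈ sphere c R, DifferentiableOn ℂ (fun x => h x ζ) U) :
    DifferentiableOn ℂ (fun x => ∮ ζ in C(c, R), h x ζ) U := by
  simp only [circleIntegral, intervalIntegral.integral_of_le Real.two_pi_pos.le,
    ← integral_Icc_eq_integral_Ioc]
  refine differentiableOn_setIntegral volume hU isCompact_Icc ?_ fun t _ =>
    (hd _ (circleMap_mem_sphere c hR t)).const_smul _
  refine ContinuousOn.smul (by simp only [deriv_circleMap]; fun_prop) ?_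
  exact hc.comp (f := fun p : E × ℝ => (p.1, circleMap c R p.2)) (by fun_prop)
    fun p hp => ⟨hp.1, circleMap_mem_sphere c hR p.2⟩

theorem differentiableOn_fderiv_apply [CompleteSpace G] (hU : IsOpen U) {f : E → G}
    (hf : DifferentiableOn ℂ f U) (e : E) :
    DifferentiableOn ℂ (fun x => fderiv ℂ f x e) U := by
  intro x hx
  have hnhds : {p : E × ℂ | p.1 + p.2 • e ∈ U} ∈ 𝓝 (x, (0 : ℂ)) := by
    refine (hU.preimage (by fun_prop : Continuous fun p : E × ℂ => p.1 + p.2 • e)).mem_nhds ?_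
    simpa using hx
  obtain ⟨V, hV, W, hW, hVW⟩ := mem_nhds_prod_iff.1 hnhds
  obtain ⟨B, hBV, hB, hxB⟩ := _root_.mem_nhds_iff.1 hV
  obtain ⟨R, hR, hRW⟩ := nhds_basis_closedBall.mem_iff.1 hW
  have hmem : ∀ y ∈ B, MapsTo (fun ζ : ℂ => y + ζ • e) (closedBall 0 R) U :=
    fun y hy ζ hζ => hVW (mk_mem_prod (hBV hy) (hRW hζ))
  have hint : DifferentiableOn ℂ (fun y => ∮ ζ in C(0, R), (ζ ^ 2)⁻¹ • f (y + ζ • e)) B := by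
    refine differentiableOn_circleIntegral hB hR.le ?_ fun ζ hζ => ?_
    · refine ContinuousOn.smul (ContinuousOn.inv₀ (by fun_prop) fun p hp => ?_) ?_
      · exact pow_ne_zero 2 (ne_of_mem_sphere hp.2 hR.ne')
      · exact hf.continuousOn.comp (by fun_prop) fun p hp =>
          hmem p.1 hp.1 (sphere_subset_closedBall hp.2)
    · exact (hf.comp (by fun_prop) fun y hy =>
        hmem y hy (sphere_subset_closedBall hζ)).const_smul _
  refine (DifferentiableOn.congr (hint.const_smul (2 * Real.pi * Complex.I : ℂ)⁻¹)
    fun y hy => ?_).differentiableAt (hB.mem_nhds hxB) |>.differentiableWithinAt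
  exact fderiv_apply_eq_circleIntegral hU hf hR (hmem y hy)

end HolomorphicParameters

-- The normalised measure used by `UnitAddTorus.mFourierCoeff`, where it is a local instance too.
local instance : MeasureSpace UnitAddCircle := ⟨AddCircle.haarAddCircle⟩

local instance : Measure.IsAddHaarMeasure (volume : Measure UnitAddCircle) :=
  inferInstanceAs (Measure.IsAddHaarMeasure AddCircle.haarAddCircle)

local instance : IsProbabilityMeasure (volume : Measure UnitAddCircle) :=
  inferInstanceAs (IsProbabilityMeasure AddCircle.haarAddCircle)

section UnitTorus

variable {ι : Type*}

/-- The covering homomorphism `ℝ^ι → (ℝ / ℤ)^ι`. -/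
def torusCover : (ι → ℝ) →+ UnitAddTorus ι where
  toFun x i := (x i : UnitAddCircle)
  map_zero' := rfl
  map_add' _ _ := rfl

theorem continuous_torusCover : Continuous (torusCover : (ι → ℝ) → UnitAddTorus ι) :=
  continuous_pi fun i => (AddCircle.continuous_mk' 1).comp (continuous_apply i)

/-- The point `(exp (2 π i θ₁), …, exp (2 π i θ_d))` of the unit torus in `ℂ^ι`; the additive torus
serves as parameter space because Mathlib's Fourier theory lives there. -/
def torusPoint (θ : UnitAddTorus ι) : ι → ℂ := fun i => ((θ i).toCircle : ℂ)

theorem norm_torusPoint (θ : UnitAddTorus ι) (i : ι) : ‖torusPoint θ i‖ = 1 := Circle.norm_coe _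

theorem torusPoint_ne_zero (θ : UnitAddTorus ι) (i : ι) : torusPoint θ i ≠ 0 := Circle.coe_ne_zero _

theorem torusPoint_add (θ φ : UnitAddTorus ι) (i : ι) :
    torusPoint (θ + φ) i = torusPoint θ i * torusPoint φ i := by
  simp only [torusPoint, Pi.add_apply, AddCircle.toCircle_add, Circle.coe_mul]

theorem continuous_torusPoint : Continuous (torusPoint : UnitAddTorus ι → ι → ℂ) :=
  continuous_pi fun i =>
    continuous_subtype_val.comp (AddCircle.continuous_toCircle.comp (continuous_apply i))

theorem injective_torusPoint : Function.Injective (torusPoint : UnitAddTorus ι → ι → ℂ) :=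
  fun _ _ h => funext fun i =>
    AddCircle.injective_toCircle one_ne_zero (Circle.coe_injective (congr_fun h i))

theorem exists_torusPoint_eq {z : ι → ℂ} (hz : ∀ i, ‖z i‖ = 1) : ∃ θ, torusPoint θ = z := by
  choose θ hθ using fun i => (AddCircle.homeomorphCircle one_ne_zero).surjective
    (⟨z i, mem_sphere_zero_iff_norm.2 (hz i)⟩ : Circle)
  refine ⟨θ, funext fun i => ?_⟩
  rw [torusPoint, ← AddCircle.homeomorphCircle_apply one_ne_zero, hθ]

theorem torusPoint_torusCover (x : ι → ℝ) (i : ι) :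
    torusPoint (torusCover x) i = Complex.exp (2 * Real.pi * Complex.I * x i) := by
  change ((AddCircle.toCircle ((x i : ℝ) : UnitAddCircle) : Circle) : ℂ) = _
  rw [AddCircle.toCircle_apply_mk, Circle.coe_exp]
  push_cast
  congr 1
  ring

variable [Fintype ι]

theorem mFourier_apply (n : ι → ℤ) (θ : UnitAddTorus ι) :
    UnitAddTorus.mFourier n θ = ∏ i, torusPoint θ i ^ n i := by
  simp only [UnitAddTorus.mFourier, ContinuousMap.coe_mk, fourier_apply, torusPoint,
    AddCircle.toCircle_zsmul, Circle.coe_zpow]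

theorem mFourier_apply_add (n : ι → ℤ) (θ φ : UnitAddTorus ι) :
    UnitAddTorus.mFourier n (θ + φ) = UnitAddTorus.mFourier n θ * UnitAddTorus.mFourier n φ := by
  simp only [mFourier_apply, torusPoint_add, mul_zpow, Finset.prod_mul_distrib]

theorem mFourier_torusCover (n : ι → ℤ) (x : ι → ℝ) :
    UnitAddTorus.mFourier n (torusCover x) =
      Complex.exp (2 * Real.pi * Complex.I * (∑ i, n i * x i : ℝ)) := by
  simp only [mFourier_apply, torusPoint_torusCover, ← Complex.exp_int_mul, ← Complex.exp_sum]
  push_cast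
  rw [Finset.mul_sum]
  congr 1
  exact Finset.sum_congr rfl fun i _ => by ring

theorem mFourierCoeff_comp_add_right (g : UnitAddTorus ι → ℂ) (φ : UnitAddTorus ι) (n : ι → ℤ) :
    UnitAddTorus.mFourierCoeff (fun θ => g (θ + φ)) n =
      UnitAddTorus.mFourier n φ * UnitAddTorus.mFourierCoeff g n := by
  have hφ : UnitAddTorus.mFourier n φ * UnitAddTorus.mFourier (-n) φ = 1 := by
    rw [← UnitAddTorus.mFourier_add, add_neg_cancel, UnitAddTorus.mFourier_zero]
    rfl
  simp only [UnitAddTorus.mFourierCoeff, smul_eq_mul]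
  rw [← integral_add_right_eq_self (fun θ => UnitAddTorus.mFourier (-n) θ * g θ) φ,
    ← integral_const_mul]
  refine integral_congr_ae (.of_forall fun θ => ?_)
  simp only [mFourier_apply_add]
  linear_combination (-UnitAddTorus.mFourier (-n) θ * g (θ + φ)) * hφ

theorem sum_sq_mFourierCoeff_le {g : UnitAddTorus ι → ℂ} (hg : Continuous g) {M : ℝ}
    (hM : ∀ θ, ‖g θ‖ ≤ M) (S : Finset (ι → ℤ)) :
    ∑ n ∈ S, ‖UnitAddTorus.mFourierCoeff g n‖ ^ 2 ≤ M ^ 2 := by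
  let g' : C(UnitAddTorus ι, ℂ) := ⟨g, hg⟩
  have hparseval := UnitAddTorus.hasSum_sq_mFourierCoeff (ContinuousMap.toLp 2 volume ℂ g')
  simp only [UnitAddTorus.mFourierCoeff_toLp] at hparseval
  calc ∑ n ∈ S, ‖UnitAddTorus.mFourierCoeff g n‖ ^ 2
      ≤ ∫ θ, ‖ContinuousMap.toLp 2 (volume : Measure (UnitAddTorus ι)) ℂ g' θ‖ ^ 2 :=
        sum_le_hasSum S (fun _ _ => by positivity) hparseval
    _ ≤ ∫ _θ : UnitAddTorus ι, M ^ 2 := by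
        refine integral_mono_of_nonneg (.of_forall fun _ => by positivity)
          (integrable_const _) ?_
        filter_upwards [ContinuousMap.coeFn_toLp (p := 2) (𝕜 := ℂ) volume g'] with θ hθ
        rw [hθ]
        exact pow_le_pow_left₀ (norm_nonneg _) (hM θ) 2
    _ = M ^ 2 := by simp

/-- The `n`-th Laurent coefficient `∫ f(z) z⁻ⁿ dm(z)` on the unit torus. -/
def laurentCoeff (f : (ι → ℂ) → ℂ) (n : ι → ℤ) : ℂ :=
  UnitAddTorus.mFourierCoeff (fun θ => f (torusPoint θ)) n

end UnitTorus

section Strip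

/-- The closed strip `|Re s| ≤ 1`. -/
def strip : Set ℂ := {s | s.re ∈ Icc (-1) 1}

theorem isPreconnected_strip : IsPreconnected strip :=
  ((convex_Icc (-1 : ℝ) 1).is_linear_preimage Complex.reLm.isLinear).isPreconnected

theorem neg_conj_mem_strip {s : ℂ} (hs : s ∈ strip) : -conj s ∈ strip := by
  simp only [strip, mem_ofPred_eq, mem_Icc, Complex.neg_re, Complex.conj_re] at hs ⊢
  constructor <;> linarith

theorem eqOn_strip_of_eq_on_imaginary_axis {f g : ℂ → ℂ} (hf : AnalyticOnNhd ℂ f strip)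
    (hg : AnalyticOnNhd ℂ g strip) (h : ∀ r : ℝ, f (r * Complex.I) = g (r * Complex.I)) :
    EqOn f g strip := by
  refine hf.eqOn_of_preconnected_of_frequently_eq hg isPreconnected_strip (z₀ := 0)
    (by simp [strip]) ?_
  have ht : Tendsto (fun r : ℝ => (r : ℂ) * Complex.I) (𝓝[≠] 0) (𝓝[≠] 0) := by
    refine tendsto_nhdsWithin_iff.2 ⟨?_, ?_⟩
    · exact (Continuous.tendsto' (by fun_prop) _ _ (by simp)).mono_left nhdsWithin_le_nhds
    · filter_upwards [self_mem_nhdsWithin] with r hr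
      simpa using hr
  exact ht.frequently (Eventually.of_forall h).frequently

theorem analyticOnNhd_conj_comp_neg_conj {u : ℂ → ℂ} (hu : AnalyticOnNhd ℂ u strip) :
    AnalyticOnNhd ℂ (fun s => conj (u (-conj s))) strip := by
  intro s hs
  have hd := Complex.analyticAt_iff_eventually_differentiableAt.1 (hu _ (neg_conj_mem_strip hs))
  have hcont : Tendsto (fun s : ℂ => -conj s) (𝓝 s) (𝓝 (-conj s)) :=
    Continuous.tendsto (by fun_prop) s
  refine Complex.analyticAt_iff_eventually_differentiableAt.2 ?_
  filter_upwards [hcont.eventually hd] with w hw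
  have hneg : DifferentiableAt ℂ (fun s => u (-s)) (conj w) :=
    DifferentiableAt.comp (conj w) hw differentiableAt_id.neg
  simpa [Function.comp_def] using hneg.conj_conj

-- Reflection: `u s * conj (u (-conj s))` is analytic and equal to `1` on the imaginary axis.
theorem ne_zero_of_norm_eq_one_on_imaginary_axis {u : ℂ → ℂ} (hu : AnalyticOnNhd ℂ u strip)
    (h1 : ∀ r : ℝ, ‖u (r * Complex.I)‖ = 1) {s : ℂ} (hs : s ∈ strip) : u s ≠ 0 := by
  have hone : EqOn (fun s => u s * conj (u (-conj s))) (fun _ => 1) strip := by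
    refine eqOn_strip_of_eq_on_imaginary_axis (hu.mul (analyticOnNhd_conj_comp_neg_conj hu))
      analyticOnNhd_const fun r => ?_
    rw [show -conj ((r : ℂ) * Complex.I) = r * Complex.I by simp, Complex.mul_conj', h1]
    simp
  exact left_ne_zero_of_mul ((hone hs).trans_ne one_ne_zero)

end Strip

section Spread

variable {ι : Type*} {v : ι → ℝ}

/-- The torus `{|z| = exp (Re s • v)}` parametrised by `θ`, with arguments shifted by `Im s • v`;
holomorphic in `s`, it joins the unit torus (`s = 0`) to the torus `{|z| = exp v}` (`s = 1`). -/
def spread (v : ι → ℝ) (θ : UnitAddTorus ι) (s : ℂ) : ι → ℂ :=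
  fun i => torusPoint θ i * Complex.exp (s * v i)

/-- The union of the tori `{|z| = exp (t • v)}`, `-1 ≤ t ≤ 1`. -/
def slab (v : ι → ℝ) : Set (ι → ℂ) :=
  {z | ∃ t ∈ Icc (-1 : ℝ) 1, ∀ i, ‖z i‖ = Real.exp (t * v i)}

theorem norm_spread (θ : UnitAddTorus ι) (s : ℂ) (i : ι) :
    ‖spread v θ s i‖ = Real.exp (s.re * v i) := by
  rw [spread, norm_mul, norm_torusPoint, Complex.norm_exp]
  simp

theorem spread_mem_slab (θ : UnitAddTorus ι) {s : ℂ} (hs : s ∈ strip) :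
    spread v θ s ∈ slab v := ⟨s.re, hs, norm_spread θ s⟩

theorem spread_mul_I (θ : UnitAddTorus ι) (r : ℝ) :
    spread v θ (r * Complex.I) =
      torusPoint (θ + torusCover fun i => r * v i / (2 * Real.pi)) := by
  ext i
  rw [spread, torusPoint_add, torusPoint_torusCover]
  have hπ : (Real.pi : ℂ) ≠ 0 := mod_cast Real.pi_ne_zero
  push_cast
  congr 2
  field_simp

theorem exists_spread_eq {z : ι → ℂ} {t : ℝ} (hz : ∀ i, ‖z i‖ = Real.exp (t * v i)) :
    ∃ θ, spread v θ t = z := by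
  obtain ⟨θ, hθ⟩ := exists_torusPoint_eq (z := fun i => z i / Complex.exp (t * v i)) fun i => by
    rw [norm_div, hz, Complex.norm_exp]
    simp
  exact ⟨θ, funext fun i => by rw [spread, hθ]; exact div_mul_cancel₀ _ (Complex.exp_ne_zero _)⟩

theorem continuous_spread : Continuous fun p : ℂ × UnitAddTorus ι => spread v p.2 p.1 :=
  continuous_pi fun i =>
    (((continuous_apply i).comp continuous_torusPoint).comp continuous_snd).mul (by fun_prop)

theorem differentiable_spread (θ : UnitAddTorus ι) : Differentiable ℂ (spread v θ) :=
  differentiable_pi.2 fun i => by unfold spread; fun_prop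

variable {U : Set (ι → ℂ)} {f : (ι → ℂ) → ℂ}

theorem exists_isOpen_strip_subset (hU : IsOpen U) (hv : slab v ⊆ U) :
    ∃ S : Set ℂ, IsOpen S ∧ strip ⊆ S ∧ ∀ s ∈ S, ∀ θ, spread v θ s ∈ U := by
  refine ⟨{s | ∀ θ, spread v θ s ∈ U}, isOpen_iff_eventually.2 fun s hs => ?_,
    fun s hs θ => hv (spread_mem_slab θ hs), fun s hs => hs⟩
  have h := isCompact_univ.eventually_forall_of_forall_eventually
    (P := fun s θ => spread v θ s ∈ U) (x₀ := s) fun θ _ =>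
      (continuous_spread.tendsto (s, θ)).eventually (hU.mem_nhds (hs θ))
  filter_upwards [h] with s' hs' θ using hs' θ (mem_univ θ)

theorem analyticOnNhd_comp_spread [Finite ι] (hU : IsOpen U) (hv : slab v ⊆ U)
    (hf : DifferentiableOn ℂ f U) (θ : UnitAddTorus ι) :
    AnalyticOnNhd ℂ (fun s => f (spread v θ s)) strip := by
  have := Fintype.ofFinite ι
  obtain ⟨S, hS, hsub, hSU⟩ := exists_isOpen_strip_subset hU hv
  refine (DifferentiableOn.analyticOnNhd ?_ hS).mono hsub
  exact hf.comp (differentiable_spread θ).differentiableOn fun s hs => hSU s hs θ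

theorem ne_zero_of_mem_slab [Finite ι] (hU : IsOpen U) (hv : slab v ⊆ U)
    (hf : DifferentiableOn ℂ f U) (h1 : ∀ θ, ‖f (torusPoint θ)‖ = 1)
    {z : ι → ℂ} (hz : z ∈ slab v) : f z ≠ 0 := by
  obtain ⟨t, ht, hzt⟩ := hz
  obtain ⟨θ, rfl⟩ := exists_spread_eq hzt
  exact ne_zero_of_norm_eq_one_on_imaginary_axis (analyticOnNhd_comp_spread hU hv hf θ)
    (fun r => by rw [spread_mul_I, h1]) (s := t) (by simpa [strip] using ht)

variable [Fintype ι]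

theorem analyticOnNhd_mFourierCoeff_spread (hU : IsOpen U) (hv : slab v ⊆ U)
    (hf : DifferentiableOn ℂ f U) (n : ι → ℤ) :
    AnalyticOnNhd ℂ (fun s => UnitAddTorus.mFourierCoeff (fun θ => f (spread v θ s)) n) strip := by
  obtain ⟨S, hS, hsub, hSU⟩ := exists_isOpen_strip_subset hU hv
  have hint : DifferentiableOn ℂ (fun s => ∫ θ in univ,
      UnitAddTorus.mFourier (-n) θ • f (spread v θ s)) S := by
    refine differentiableOn_setIntegral volume hS isCompact_univ ?_ fun θ _ => ?_
    · have hmFourier : ContinuousOn (fun p : ℂ × UnitAddTorus ι => UnitAddTorus.mFourier (-n) p.2)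
          (S ×ˢ univ) := by fun_prop
      exact hmFourier.smul (hf.continuousOn.comp continuous_spread.continuousOn
        fun p hp => hSU _ hp.1 _)
    · exact (hf.comp (differentiable_spread θ).differentiableOn fun s hs =>
        hSU s hs θ).const_smul (UnitAddTorus.mFourier (-n) θ)
  simp only [setIntegral_univ] at hint
  exact (hint.analyticOnNhd hS).mono hsub

-- Both sides are analytic in `s`; on the imaginary axis `spread` is a rotation of the unit torus.
theorem mFourierCoeff_spread (hU : IsOpen U) (hv : slab v ⊆ U) (hf : DifferentiableOn ℂ f U)
    (n : ι → ℤ) {s : ℂ} (hs : s ∈ strip) :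
    UnitAddTorus.mFourierCoeff (fun θ => f (spread v θ s)) n =
      Complex.exp (s * (∑ i, n i * v i : ℝ)) * laurentCoeff f n := by
  refine eqOn_strip_of_eq_on_imaginary_axis (analyticOnNhd_mFourierCoeff_spread hU hv hf n)
    (g := fun s => Complex.exp (s * (∑ i, n i * v i : ℝ)) * laurentCoeff f n)
    (fun s _ => by fun_prop) (fun r => ?_) hs
  simp only [spread_mul_I]
  rw [mFourierCoeff_comp_add_right (fun θ => f (torusPoint θ)), mFourier_torusCover, laurentCoeff]
  have hπ : (Real.pi : ℂ) ≠ 0 := mod_cast Real.pi_ne_zero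
  congr 2
  simp only [mul_div_assoc', ← Finset.sum_div]
  push_cast
  simp only [Finset.mul_sum, Finset.sum_div]
  exact Finset.sum_congr rfl fun i _ => by field_simp

theorem sum_sq_laurentCoeff_le (hU : IsOpen U) (hv : slab v ⊆ U) (hf : DifferentiableOn ℂ f U)
    {M : ℝ} (hM : ∀ z : ι → ℂ, (∀ i, ‖z i‖ = Real.exp (v i)) → ‖f z‖ ≤ M) (S : Finset (ι → ℤ)) :
    ∑ n ∈ S, (‖laurentCoeff f n‖ * Real.exp (∑ i, n i * v i)) ^ 2 ≤ M ^ 2 := by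
  have h1 : (1 : ℂ) ∈ strip := by simp [strip]
  have hc : Continuous fun θ : UnitAddTorus ι => f (spread v θ 1) :=
    hf.continuousOn.comp_continuous (continuous_spread.comp (by fun_prop :
      Continuous fun θ : UnitAddTorus ι => ((1 : ℂ), θ))) fun θ => hv (spread_mem_slab θ h1)
  refine le_trans (le_of_eq ?_)
    (sum_sq_mFourierCoeff_le hc (fun θ => hM _ fun i => by simp [norm_spread]) S)
  refine Finset.sum_congr rfl fun n _ => ?_
  rw [mFourierCoeff_spread hU hv hf n h1, norm_mul, Complex.norm_exp, mul_comm]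
  simp

end Spread

section ChangeOfVariables

variable {ι : Type*}

theorem countable_ker_torusCover [Finite ι] : Countable (torusCover (ι := ι)).ker := by
  have hker : ((torusCover (ι := ι)).ker : Set (ι → ℝ)) ⊆
      range fun (n : ι → ℤ) i => (n i : ℝ) := by
    intro x hx
    choose n hn using fun i =>
      (AddCircle.coe_eq_zero_iff 1).1 (congr_fun (AddMonoidHom.mem_ker.1 hx) i)
    exact ⟨n, funext fun i => by simpa using hn i⟩
  exact ((countable_range _).mono hker).to_subtype

/-- The half-open unit cube, a fundamental domain of `torusCover`. The bound `0 + 1` is the form in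
which Mathlib's integration theory on `UnitAddTorus` presents it. -/
def unitCube : Set (ι → ℝ) := {x | ∀ i, x i ∈ Ioc (0 : ℝ) (0 + 1)}

theorem measurableSet_unitCube [Finite ι] : MeasurableSet (unitCube : Set (ι → ℝ)) :=
  MeasurableSet.univ_pi' fun _ => measurableSet_Ioc

theorem bijOn_torusCover_unitCube : BijOn (torusCover (ι := ι)) unitCube univ := by
  refine ⟨fun _ _ => mem_univ _, fun x hx y hy h => funext fun i => ?_, fun t _ => ?_⟩
  · exact congr_arg Subtype.val ((AddCircle.equivIoc (1 : ℝ) 0).symm.injective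
      (a₁ := ⟨x i, hx i⟩) (a₂ := ⟨y i, hy i⟩) (congr_fun h i))
  · exact ⟨fun i => AddCircle.equivIoc 1 0 (t i), fun i => (AddCircle.equivIoc 1 0 (t i)).2,
      funext fun i => (AddCircle.equivIoc (1 : ℝ) 0).symm_apply_apply (t i)⟩

theorem continuous_of_torusPoint_comp {τ : UnitAddTorus ι → UnitAddTorus ι}
    (h : Continuous fun θ => torusPoint (τ θ)) : Continuous τ :=
  (continuous_torusPoint.isClosedEmbedding injective_torusPoint).isEmbedding.continuous_iff.2 h

theorem exists_continuous_lift {τ : UnitAddTorus ι → UnitAddTorus ι} (hτ : Continuous τ) :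
    ∃ g : (ι → ℝ) → (ι → ℝ), Continuous g ∧ ∀ x, torusCover (g x) = τ (torusCover x) := by
  have h : ∀ i, ∃ f : C(ι → ℝ, ℝ), ∀ x, (f x : UnitAddCircle) = τ (torusCover x) i := by
    intro i
    let c : C(ι → ℝ, UnitAddCircle) :=
      ⟨fun x => τ (torusCover x) i, (continuous_apply i).comp (hτ.comp continuous_torusCover)⟩
    obtain ⟨e₀, he₀⟩ := QuotientAddGroup.mk_surjective (c 0)
    obtain ⟨f, hf, -⟩ := (AddCircle.isCoveringMap_coe (1 : ℝ)).existsUnique_continuousMap_lifts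
      c 0 e₀ he₀
    exact ⟨f, fun x => congr_fun hf.2 x⟩
  choose f hf using h
  exact ⟨fun x i => f i x, by fun_prop, fun x => funext fun i => hf i x⟩

theorem differentiableAt_of_cexp_comp {𝕜 E : Type*} [NontriviallyNormedField 𝕜]
    [NormedAlgebra 𝕜 ℂ] [NormedAddCommGroup E] [NormedSpace 𝕜 E] {L : E → ℂ} {x : E}
    (hL : ContinuousAt L x) (h : DifferentiableAt 𝕜 (fun y => Complex.exp (L y)) x) :
    DifferentiableAt 𝕜 L x := by
  have hexp := Complex.hasStrictDerivAt_exp (L x)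
  have hne := Complex.exp_ne_zero (L x)
  have hinv := (hexp.to_localInverse hne).hasDerivAt.comp_hasFDerivAt x h.hasFDerivAt
  refine (hinv.congr_of_eventuallyEq ?_).differentiableAt
  filter_upwards [hL.eventually (hexp.eventually_left_inverse hne)] with y hy
  exact hy.symm

/-- The real derivative of `x ↦ torusPoint (torusCover x)`. -/
def torusDeriv (x : ι → ℝ) : (ι → ℝ) →L[ℝ] (ι → ℂ) :=
  ContinuousLinearMap.pi fun i => (2 * Real.pi * Complex.I * torusPoint (torusCover x) i) •
    (Complex.ofRealCLM ∘L ContinuousLinearMap.proj i)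

theorem torusDeriv_apply (x w : ι → ℝ) (i : ι) :
    torusDeriv x w i = 2 * Real.pi * Complex.I * torusPoint (torusCover x) i * w i := rfl

theorem injective_torusDeriv (x : ι → ℝ) : Function.Injective (torusDeriv x) := by
  refine (injective_iff_map_eq_zero _).2 fun w hw => funext fun i => ?_
  simpa [torusDeriv_apply, torusPoint_ne_zero] using congr_fun hw i

theorem torusDeriv_single [DecidableEq ι] (x : ι → ℝ) (b : ι) :
    torusDeriv x (Pi.single b 1) =
      (2 * Real.pi * Complex.I * torusPoint (torusCover x) b) • Pi.single b (1 : ℂ) := by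
  ext i
  rcases eq_or_ne i b with rfl | hi
  · simp [torusDeriv_apply]
  · simp [torusDeriv_apply, hi]

theorem differentiableAt_of_torusPoint_torusCover_comp [Finite ι] {E : Type*} [NormedAddCommGroup E]
    [NormedSpace ℝ E] {g : E → ι → ℝ} {x : E} (hg : ContinuousAt g x)
    (h : DifferentiableAt ℝ (fun y => torusPoint (torusCover (g y))) x) :
    DifferentiableAt ℝ g x := by
  refine differentiableAt_pi.2 fun i => ?_
  have hgi : ContinuousAt (fun y => g y i) x := (continuous_apply i).continuousAt.comp hg
  have hlog : DifferentiableAt ℝ (fun y => 2 * Real.pi * Complex.I * g y i) x :=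
    differentiableAt_of_cexp_comp (by fun_prop)
      (by simpa only [torusPoint_torusCover] using differentiableAt_pi.1 h i)
  have hre := Complex.reCLM.differentiableAt.comp x
    (hlog.const_mul (2 * Real.pi * Complex.I : ℂ)⁻¹)
  simpa only [Function.comp_def, inv_mul_cancel_left₀ Complex.two_pi_I_ne_zero,
    Complex.reCLM_apply, Complex.ofReal_re] using hre

theorem hasFDerivAt_torusPoint_torusCover [Finite ι] (x : ι → ℝ) :
    HasFDerivAt (fun y => torusPoint (torusCover y)) (torusDeriv x) x := by
  have := Fintype.ofFinite ι
  refine hasFDerivAt_pi.2 fun i => ?_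
  simp only [torusPoint_torusCover]
  have hcoord := (Complex.ofRealCLM ∘L
    ContinuousLinearMap.proj (R := ℝ) (φ := fun _ : ι => ℝ) i).hasFDerivAt (x := x)
  refine (hcoord.const_mul (2 * Real.pi * Complex.I)).cexp.congr_fderiv ?_
  rw [smul_smul, mul_comm]
  rfl

variable {F G : (ι → ℂ) → (ι → ℂ)} {g : (ι → ℝ) → (ι → ℝ)}

theorem isOpen_inter_forall_ne_zero [Finite ι] {V : Set (ι → ℂ)} (hV : IsOpen V)
    (hG : ContinuousOn G V) :
    IsOpen (V ∩ {z | ∀ i, G z i ≠ 0}) := by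
  refine hG.isOpen_inter_preimage hV (t := {w | ∀ i, w i ≠ 0}) ?_
  simp only [ofPred_forall]
  exact isOpen_iInter_of_finite fun i => isOpen_ne_fun (continuous_apply i) continuous_const

theorem torusDeriv_comp_fderiv_eq [Finite ι] {x : ι → ℝ} (hg : DifferentiableAt ℝ g x)
    (hG : DifferentiableAt ℂ G (torusPoint (torusCover x)))
    (h : ∀ y, G (torusPoint (torusCover y)) = torusPoint (torusCover (g y))) :
    torusDeriv (g x) ∘L fderiv ℝ g x =
      (fderiv ℂ G (torusPoint (torusCover x))).restrictScalars ℝ ∘L torusDeriv x := by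
  have := Fintype.ofFinite ι
  have hleft := (hasFDerivAt_torusPoint_torusCover (g x)).comp x hg.hasFDerivAt
  refine hleft.unique (.congr_of_eventuallyEq ?_ (.of_forall fun y => (h y).symm))
  exact (hG.hasFDerivAt.restrictScalars ℝ).comp x (hasFDerivAt_torusPoint_torusCover x)

theorem det_fderiv_lift_ne_zero [Finite ι] {x : ι → ℝ} (hg : DifferentiableAt ℝ g x)
    (hF : DifferentiableAt ℂ F (torusPoint (torusCover (g x))))
    (h : ∀ y, F (torusPoint (torusCover (g y))) = torusPoint (torusCover y)) :
    (fderiv ℝ g x).det ≠ 0 := by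
  have := Fintype.ofFinite ι
  have hchain : torusDeriv x = (fderiv ℂ F (torusPoint (torusCover (g x)))).restrictScalars ℝ ∘L
      (torusDeriv (g x) ∘L fderiv ℝ g x) := by
    refine (hasFDerivAt_torusPoint_torusCover x).unique
      (.congr_of_eventuallyEq ?_ (.of_forall fun y => (h y).symm))
    exact (hF.hasFDerivAt.restrictScalars ℝ).comp x
      ((hasFDerivAt_torusPoint_torusCover (g x)).comp x hg.hasFDerivAt)
  intro hdet
  obtain ⟨w, hw, hw0⟩ := Submodule.exists_mem_ne_zero_of_ne_bot
    (LinearMap.det_eq_zero_iff_ker_ne_bot.1 hdet)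
  have hw : fderiv ℝ g x w = 0 := hw
  refine hw0 (injective_torusDeriv x ?_)
  rw [hchain]
  simp [hw]

variable [Fintype ι]

theorem integral_eq_setIntegral_unitCube (u : UnitAddTorus ι → ℂ) :
    ∫ θ, u θ = ∫ x in unitCube, u (torusCover x) :=
  UnitAddTorus.integral_preimage u fun _ => 0

theorem isAddFundamentalDomain_of_bijOn {s : Set (ι → ℝ)} (hs : MeasurableSet s)
    (h : BijOn torusCover s univ) : IsAddFundamentalDomain (torusCover (ι := ι)).ker s := by
  refine IsAddFundamentalDomain.mk' hs.nullMeasurableSet fun x => ?_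
  obtain ⟨y, hy, hxy⟩ := h.surjOn (mem_univ (torusCover x))
  refine ⟨⟨y - x, by simp [AddMonoidHom.mem_ker, hxy]⟩, ?_, ?_⟩
  · simpa [AddSubgroup.vadd_def] using hy
  · rintro ⟨k, hk⟩ (hkx : k + x ∈ s)
    have hcover : torusCover (k + x) = torusCover y := by
      rw [map_add, AddMonoidHom.mem_ker.1 hk, zero_add, hxy]
    exact Subtype.ext (eq_sub_of_add_eq (h.injOn hkx hy hcover))

theorem setIntegral_eq_of_bijOn_torusCover {s t : Set (ι → ℝ)} (hs : MeasurableSet s)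
    (ht : MeasurableSet t) (hsb : BijOn torusCover s univ) (htb : BijOn torusCover t univ)
    (u : UnitAddTorus ι → ℂ) :
    ∫ x in s, u (torusCover x) = ∫ x in t, u (torusCover x) := by
  have := countable_ker_torusCover (ι := ι)
  refine (isAddFundamentalDomain_of_bijOn hs hsb).setIntegral_eq
    (isAddFundamentalDomain_of_bijOn ht htb) ?_
  rintro ⟨k, hk⟩ x
  change u (torusCover (k + x)) = _
  rw [map_add, AddMonoidHom.mem_ker.1 hk, zero_add]

theorem integral_eq_of_lift (τ : UnitAddTorus ι ≃ UnitAddTorus ι) {g : (ι → ℝ) → (ι → ℝ)}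
    {g' : (ι → ℝ) → (ι → ℝ) →L[ℝ] (ι → ℝ)} (hg : ∀ x, HasFDerivAt g (g' x) x)
    (hlift : ∀ x, torusCover (g x) = τ (torusCover x)) (u : UnitAddTorus ι → ℂ) :
    ∫ θ, u θ = ∫ x in unitCube, |(g' x).det| • u (τ (torusCover x)) := by
  have hinj : InjOn g unitCube := fun x hx y hy hxy =>
    bijOn_torusCover_unitCube.injOn hx hy (τ.injective (by rw [← hlift, ← hlift, hxy]))
  have hg' : ∀ x ∈ unitCube, HasFDerivWithinAt g (g' x) unitCube x :=
    fun x _ => (hg x).hasFDerivWithinAt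
  have hbij : BijOn torusCover (g '' unitCube) univ := by
    refine ⟨fun _ _ => mem_univ _, ?_, fun t _ => ?_⟩
    · rintro _ ⟨x, hx, rfl⟩ _ ⟨y, hy, rfl⟩ hxy
      rw [hlift, hlift] at hxy
      rw [bijOn_torusCover_unitCube.injOn hx hy (τ.injective hxy)]
    · obtain ⟨x, hx, hxt⟩ := bijOn_torusCover_unitCube.surjOn (mem_univ (τ.symm t))
      exact ⟨g x, mem_image_of_mem g hx, by rw [hlift, hxt, τ.apply_symm_apply]⟩
  rw [integral_eq_setIntegral_unitCube, setIntegral_eq_of_bijOn_torusCover measurableSet_unitCube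
    (measurable_image_of_fderivWithin measurableSet_unitCube hg' hinj)
    bijOn_torusCover_unitCube hbij,
    integral_image_eq_integral_abs_det_fderiv_smul volume measurableSet_unitCube hg' hinj]
  simp only [hlift]

theorem exists_abs_eq_mul_of_ne_zero {X : Type*} [TopologicalSpace X] [PreconnectedSpace X]
    {d : X → ℝ} (hd : Continuous d) (h0 : ∀ x, d x ≠ 0) :
    ∃ ε : ℝ, |ε| = 1 ∧ ∀ x, |d x| = ε * d x := by
  rcases isPreconnected_univ.eq_or_eq_neg_of_sq_eq hd.abs.continuousOn hd.continuousOn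
    (fun x _ => sq_abs (d x)) (fun {x} _ => h0 x) with h | h
  · exact ⟨1, abs_one, fun x => by rw [one_mul]; exact h (mem_univ x)⟩
  · exact ⟨-1, by simp, fun x => by rw [neg_one_mul]; exact h (mem_univ x)⟩

variable [DecidableEq ι]

/-- The matrix `z_b ∂_b G_a / G_a`: the Jacobian matrix of `G` in logarithmic coordinates. -/
def logJacobian (G : (ι → ℂ) → (ι → ℂ)) (z : ι → ℂ) : Matrix ι ι ℂ :=
  Matrix.of fun a b => z b * fderiv ℂ G z (Pi.single b 1) a / G z a

theorem differentiableOn_det_logJacobian {V : Set (ι → ℂ)} (hV : IsOpen V)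
    (hG : DifferentiableOn ℂ G V) (h0 : ∀ z ∈ V, ∀ i, G z i ≠ 0) :
    DifferentiableOn ℂ (fun z => (logJacobian G z).det) V := by
  have hentry : ∀ a b, DifferentiableOn ℂ (fun z => logJacobian G z a b) V := fun a b => by
    simp only [logJacobian, Matrix.of_apply, div_eq_mul_inv]
    exact (DifferentiableOn.mul (by fun_prop)
      (differentiableOn_pi.1 (differentiableOn_fderiv_apply hV hG _) a)).mul
      ((differentiableOn_pi.1 hG a).fun_inv fun z hz => h0 z hz a)
  simp only [Matrix.det_apply']
  exact DifferentiableOn.fun_sum fun σ _ => DifferentiableOn.const_mul (fun z hz =>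
    (HasFDerivWithinAt.finsetProd fun i _ =>
      (hentry _ _ z hz).hasFDerivWithinAt).differentiableWithinAt) _

theorem det_fderiv_lift_eq {x : ι → ℝ} (hg : DifferentiableAt ℝ g x)
    (hG : DifferentiableAt ℂ G (torusPoint (torusCover x)))
    (h : ∀ y, G (torusPoint (torusCover y)) = torusPoint (torusCover (g y))) :
    ((fderiv ℝ g x).det : ℂ) = (logJacobian G (torusPoint (torusCover x))).det := by
  have hentry : ∀ a b, ((fderiv ℝ g x (Pi.single b 1) a : ℝ) : ℂ) =
      logJacobian G (torusPoint (torusCover x)) a b := fun a b => by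
    have hchain := congr_fun (DFunLike.congr_fun (torusDeriv_comp_fderiv_eq hg hG h)
      (Pi.single b 1)) a
    rw [ContinuousLinearMap.comp_apply, ContinuousLinearMap.comp_apply, torusDeriv_single,
      ContinuousLinearMap.coe_restrictScalars', map_smul, torusDeriv_apply, Pi.smul_apply,
      smul_eq_mul] at hchain
    rw [logJacobian, Matrix.of_apply, h, eq_div_iff (torusPoint_ne_zero _ a)]
    refine mul_left_cancel₀ Complex.two_pi_I_ne_zero ?_
    linear_combination hchain
  rw [ContinuousLinearMap.det, ← LinearMap.det_toMatrix', ← Complex.ofRealHom_eq_coe,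
    RingHom.map_det]
  congr 1
  ext a b
  simp [LinearMap.toMatrix'_apply, ← hentry]

theorem exists_integral_eq_integral_det_logJacobian_mul (τ : UnitAddTorus ι ≃ UnitAddTorus ι)
    {V : Set (ι → ℂ)} (hV : IsOpen V) (hGV : DifferentiableOn ℂ G V)
    (hτV : ∀ θ, torusPoint θ ∈ V) (hG : ∀ θ, G (torusPoint θ) = torusPoint (τ θ))
    (hFd : ∀ θ, DifferentiableAt ℂ F (torusPoint θ))
    (hF : ∀ θ, F (torusPoint θ) = torusPoint (τ.symm θ)) :
    ∃ ε : ℂ, ‖ε‖ = 1 ∧ ∀ u : UnitAddTorus ι → ℂ,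
      ∫ θ, u θ = ∫ θ, ε * (logJacobian G (torusPoint θ)).det * u (τ θ) := by
  have hGd : ∀ θ, DifferentiableAt ℂ G (torusPoint θ) :=
    fun θ => hGV.differentiableAt (hV.mem_nhds (hτV θ))
  obtain ⟨g, hgc, hlift⟩ := exists_continuous_lift <| continuous_of_torusPoint_comp <|
    (hGV.continuousOn.comp_continuous continuous_torusPoint hτV).congr hG
  have hGg : ∀ y, G (torusPoint (torusCover y)) = torusPoint (torusCover (g y)) :=
    fun y => by rw [hG, hlift]
  have hg : ∀ x, DifferentiableAt ℝ g x := fun x => by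
    refine differentiableAt_of_torusPoint_torusCover_comp hgc.continuousAt ?_
    simp only [← hGg]
    exact ((hGd _).restrictScalars ℝ).comp x
      (hasFDerivAt_torusPoint_torusCover x).differentiableAt
  have hdet := fun x => det_fderiv_lift_eq (hg x) (hGd _) hGg
  have hcont : Continuous fun x => (fderiv ℝ g x).det := by
    have hV0 := isOpen_inter_forall_ne_zero hV hGV.continuousOn
    have hJ := (differentiableOn_det_logJacobian hV0 (hGV.mono inter_subset_left)
      fun z hz => hz.2).continuousOn.comp_continuous
        (continuous_torusPoint.comp continuous_torusCover)
        fun x => ⟨hτV _, fun i => by rw [Function.comp_apply, hG]; exact torusPoint_ne_zero _ i⟩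
    exact (Complex.continuous_re.comp hJ).congr fun x => by simp [← hdet]
  obtain ⟨ε, hε, habs⟩ := exists_abs_eq_mul_of_ne_zero hcont fun x =>
    det_fderiv_lift_ne_zero (hg x) (hFd _) fun y => by rw [hF, hlift, τ.symm_apply_apply]
  refine ⟨ε, by simpa using hε, fun u => ?_⟩
  rw [integral_eq_of_lift τ (fun x => (hg x).hasFDerivAt) hlift, integral_eq_setIntegral_unitCube]
  simp only [habs, Complex.real_smul, Complex.ofReal_mul, hdet]

end ChangeOfVariables

section BlockBound

variable {𝕜 ι κ : Type*} [RCLike 𝕜] {c : ι → κ → 𝕜} {u : ι → ℝ} {v : κ → ℝ}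
  {X X₁ X₂ : Set ι} {Y Y₁ Y₂ : Set κ}

/-- The infinite matrix `c`, restricted to rows in `X` and columns in `Y`, is bounded between the
weighted `ℓ²` spaces with weights `u` and `v`. -/
def BlockBound (c : ι → κ → 𝕜) (u : ι → ℝ) (v : κ → ℝ) (X : Set ι) (Y : Set κ) : Prop :=
  ∃ C : ℝ, 0 ≤ C ∧ ∀ (f : ι → 𝕜) (S : Finset ι) (S' : Finset κ), ↑S ⊆ X → ↑S' ⊆ Y →
    ∑ n ∈ S', ‖∑ m ∈ S, f m * c m n‖ ^ 2 * v n ^ 2 ≤ C * ∑ m ∈ S, ‖f m‖ ^ 2 * u m ^ 2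

theorem BlockBound.mono (h : BlockBound c u v X Y) (hX : X₁ ⊆ X) (hY : Y₁ ⊆ Y) :
    BlockBound c u v X₁ Y₁ := by
  obtain ⟨C, hC, h⟩ := h
  exact ⟨C, hC, fun f S S' hS hS' => h f S S' (hS.trans hX) (hS'.trans hY)⟩

theorem BlockBound.mono_weight {u' : ι → ℝ} {v' : κ → ℝ} (h : BlockBound c u v X Y)
    (hu : ∀ m ∈ X, |u m| ≤ |u' m|) (hv : ∀ n ∈ Y, |v' n| ≤ |v n|) : BlockBound c u' v' X Y := by
  obtain ⟨C, hC, h⟩ := h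
  refine ⟨C, hC, fun f S S' hS hS' => ?_⟩
  calc ∑ n ∈ S', ‖∑ m ∈ S, f m * c m n‖ ^ 2 * v' n ^ 2
      ≤ ∑ n ∈ S', ‖∑ m ∈ S, f m * c m n‖ ^ 2 * v n ^ 2 :=
        Finset.sum_le_sum fun n hn =>
          mul_le_mul_of_nonneg_left (sq_le_sq.2 (hv n (hS' hn))) (sq_nonneg _)
    _ ≤ C * ∑ m ∈ S, ‖f m‖ ^ 2 * u m ^ 2 := h f S S' hS hS'
    _ ≤ C * ∑ m ∈ S, ‖f m‖ ^ 2 * u' m ^ 2 :=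
        mul_le_mul_of_nonneg_left (Finset.sum_le_sum fun m hm =>
          mul_le_mul_of_nonneg_left (sq_le_sq.2 (hu m (hS hm))) (sq_nonneg _)) hC

theorem BlockBound.empty_left : BlockBound c u v ∅ Y := by
  refine ⟨0, le_rfl, fun f S S' hS _ => ?_⟩
  obtain rfl : S = ∅ := by simpa using hS
  simp

theorem BlockBound.empty_right : BlockBound c u v X ∅ := by
  refine ⟨0, le_rfl, fun f S S' _ hS' => ?_⟩
  obtain rfl : S' = ∅ := by simpa using hS'
  simp

theorem BlockBound.union_right (h₁ : BlockBound c u v X Y₁) (h₂ : BlockBound c u v X Y₂) :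
    BlockBound c u v X (Y₁ ∪ Y₂) := by
  classical
  obtain ⟨C₁, hC₁, h₁⟩ := h₁
  obtain ⟨C₂, hC₂, h₂⟩ := h₂
  refine ⟨C₁ + C₂, by positivity, fun f S S' hS hS' => ?_⟩
  rw [← Finset.sum_filter_add_sum_filter_not S' (· ∈ Y₁), add_mul]
  refine add_le_add (h₁ f S _ hS fun n hn => (Finset.mem_filter.1 hn).2)
    (h₂ f S _ hS fun n hn => ?_)
  have hn := Finset.mem_filter.1 hn
  exact (hS' hn.1).resolve_left hn.2

theorem BlockBound.union_left (h₁ : BlockBound c u v X₁ Y) (h₂ : BlockBound c u v X₂ Y) :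
    BlockBound c u v (X₁ ∪ X₂) Y := by
  classical
  obtain ⟨C₁, hC₁, h₁⟩ := h₁
  obtain ⟨C₂, hC₂, h₂⟩ := h₂
  refine ⟨2 * (C₁ + C₂), by positivity, fun f S S' hS hS' => ?_⟩
  let S₁ := S.filter (· ∈ X₁)
  let S₂ := S.filter (· ∉ X₁)
  have hS₁ : (S₁ : Set ι) ⊆ X₁ := fun m hm => (Finset.mem_filter.1 hm).2
  have hS₂ : (S₂ : Set ι) ⊆ X₂ := fun m hm =>
    (hS (Finset.mem_filter.1 hm).1).resolve_left (Finset.mem_filter.1 hm).2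
  have hsplit : ∀ n, ‖∑ m ∈ S, f m * c m n‖ ^ 2 ≤
      2 * (‖∑ m ∈ S₁, f m * c m n‖ ^ 2 + ‖∑ m ∈ S₂, f m * c m n‖ ^ 2) := fun n => by
    rw [← Finset.sum_filter_add_sum_filter_not S (· ∈ X₁)]
    exact (pow_le_pow_left₀ (norm_nonneg _) (norm_add_le _ _) 2).trans add_sq_le
  let N (S : Finset ι) : ℝ := ∑ m ∈ S, ‖f m‖ ^ 2 * u m ^ 2
  have hN : ∀ S, 0 ≤ N S := fun S => Finset.sum_nonneg fun _ _ => by positivity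
  calc ∑ n ∈ S', ‖∑ m ∈ S, f m * c m n‖ ^ 2 * v n ^ 2
      ≤ ∑ n ∈ S', 2 * (‖∑ m ∈ S₁, f m * c m n‖ ^ 2 + ‖∑ m ∈ S₂, f m * c m n‖ ^ 2) * v n ^ 2 :=
        Finset.sum_le_sum fun n _ => mul_le_mul_of_nonneg_right (hsplit n) (sq_nonneg _)
    _ = 2 * (∑ n ∈ S', ‖∑ m ∈ S₁, f m * c m n‖ ^ 2 * v n ^ 2 +
          ∑ n ∈ S', ‖∑ m ∈ S₂, f m * c m n‖ ^ 2 * v n ^ 2) := by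
        rw [← Finset.sum_add_distrib, Finset.mul_sum]
        exact Finset.sum_congr rfl fun n _ => by ring
    _ ≤ 2 * (C₁ * N S₁ + C₂ * N S₂) := by
        gcongr
        exacts [h₁ f S₁ S' hS₁ hS', h₂ f S₂ S' hS₂ hS']
    _ ≤ 2 * (C₁ + C₂) * (N S₁ + N S₂) := by
        nlinarith [mul_nonneg hC₁ (hN S₂), mul_nonneg hC₂ (hN S₁)]
    _ = 2 * (C₁ + C₂) * N S := by rw [Finset.sum_filter_add_sum_filter_not]

theorem BlockBound.biUnion_right {J : Type*} {t : Set J} (ht : t.Finite) {Y : J → Set κ}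
    (h : ∀ j ∈ t, BlockBound c u v X (Y j)) : BlockBound c u v X (⋃ j ∈ t, Y j) := by
  induction t, ht using Set.Finite.induction_on with
  | empty => simpa using empty_right
  | insert _ _ ih =>
    rw [biUnion_insert]
    exact (h _ (mem_insert _ _)).union_right (ih fun j hj => h j (mem_insert_of_mem _ hj))

theorem BlockBound.biUnion_left {J : Type*} {t : Set J} (ht : t.Finite) {X : J → Set ι}
    (h : ∀ j ∈ t, BlockBound c u v (X j) Y) : BlockBound c u v (⋃ j ∈ t, X j) Y := by
  induction t, ht using Set.Finite.induction_on with
  | empty => simpa using empty_left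
  | insert _ _ ih =>
    rw [biUnion_insert]
    exact (h _ (mem_insert _ _)).union_left (ih fun j hj => h j (mem_insert_of_mem _ hj))

theorem sq_norm_sum_mul_le (hu : ∀ m, u m ≠ 0) (f h : ι → 𝕜) (S : Finset ι) :
    ‖∑ m ∈ S, f m * h m‖ ^ 2 ≤
      (∑ m ∈ S, ‖f m‖ ^ 2 * u m ^ 2) * ∑ m ∈ S, ‖h m‖ ^ 2 * (u m)⁻¹ ^ 2 := by
  have hnorm : ‖∑ m ∈ S, f m * h m‖ ≤ ∑ m ∈ S, ‖f m‖ * |u m| * (‖h m‖ * |u m|⁻¹) :=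
    norm_sum_le_of_le S fun m _ => by
      have := abs_pos.2 (hu m)
      rw [norm_mul]
      exact le_of_eq (by field_simp)
  refine (pow_le_pow_left₀ (norm_nonneg _) hnorm 2).trans
    ((Finset.sum_mul_sq_le_sq_mul_sq _ _ _).trans_eq ?_)
  simp only [mul_pow, inv_pow, sq_abs]

-- With `b = conj (f c) v²`, the square of `‖f c‖_v` is the pairing of `f` with `c b`.
theorem BlockBound.of_transpose (hu : ∀ m, u m ≠ 0) (hv : ∀ n, v n ≠ 0)
    (h : BlockBound (fun n m => c m n) (fun n => (v n)⁻¹) (fun m => (u m)⁻¹) Y X) :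
    BlockBound c u v X Y := by
  obtain ⟨C, hC, h⟩ := h
  refine ⟨C, hC, fun f S S' hS hS' => ?_⟩
  let g (n : κ) : 𝕜 := ∑ m ∈ S, f m * c m n
  let b (n : κ) : 𝕜 := conj (g n) * (v n ^ 2 : ℝ)
  let N : ℝ := ∑ n ∈ S', ‖g n‖ ^ 2 * v n ^ 2
  let Q : ℝ := ∑ m ∈ S, ‖f m‖ ^ 2 * u m ^ 2
  have hN : 0 ≤ N := Finset.sum_nonneg fun _ _ => by positivity
  have hQ : 0 ≤ Q := Finset.sum_nonneg fun _ _ => by positivity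
  have hb : ∑ n ∈ S', ‖b n‖ ^ 2 * (v n)⁻¹ ^ 2 = N := Finset.sum_congr rfl fun n _ => by
    have := hv n
    simp only [b, norm_mul, RCLike.norm_conj, RCLike.norm_ofReal, abs_pow, sq_abs]
    field_simp
  have hpair : (N : 𝕜) = ∑ m ∈ S, f m * ∑ n ∈ S', b n * c m n := by
    simp only [Finset.mul_sum]
    rw [Finset.sum_comm, RCLike.ofReal_sum]
    refine Finset.sum_congr rfl fun n _ => ?_
    calc ((‖g n‖ ^ 2 * v n ^ 2 : ℝ) : 𝕜) = b n * g n := by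
          rw [RCLike.ofReal_mul, RCLike.ofReal_pow, ← RCLike.conj_mul, mul_right_comm]
      _ = ∑ m ∈ S, f m * (b n * c m n) := by
          simp only [g, Finset.mul_sum, mul_left_comm]
  have hsq : N ^ 2 ≤ Q * (C * N) :=
    calc N ^ 2 = ‖(N : 𝕜)‖ ^ 2 := by rw [RCLike.norm_ofReal, sq_abs]
      _ ≤ Q * ∑ m ∈ S, ‖∑ n ∈ S', b n * c m n‖ ^ 2 * (u m)⁻¹ ^ 2 := by
          rw [hpair]; exact sq_norm_sum_mul_le hu _ _ S
      _ ≤ Q * (C * N) := mul_le_mul_of_nonneg_left ((h b S' S hS' hS).trans_eq (by rw [hb])) hQ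
  rcases hN.eq_or_lt with hN0 | hN0
  · exact hN0.symm.trans_le (mul_nonneg hC hQ)
  · exact le_of_mul_le_mul_right (by linarith) hN0

theorem BlockBound.comp_neg [AddGroup ι] [AddGroup κ] (h : BlockBound c u v X Y) :
    BlockBound (fun m n => c (-m) (-n)) (fun m => u (-m)) (fun n => v (-n)) (-X) (-Y) := by
  obtain ⟨C, hC, h⟩ := h
  refine ⟨C, hC, fun f S S' hS hS' => ?_⟩
  simpa using h (fun m => f (-m)) (S.map (Equiv.neg ι).toEmbedding)
    (S'.map (Equiv.neg κ).toEmbedding)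
    (by simpa [Set.subset_def] using fun m (hm : -m ∈ S) => Set.mem_neg.1 (hS hm))
    (by simpa [Set.subset_def] using fun n (hn : -n ∈ S') => Set.mem_neg.1 (hS' hn))

end BlockBound

section Exponents

variable {P : Matrix.GeneralLinearGroup (Fin 2) ℝ} {A : Fin 2 → ℝ} {τ : Fin 2 → ℤˣ} {n : Fin 2 → ℤ}

theorem abs_sgn (s : ℤˣ) : |sgn s| = 1 := by
  rcases Int.units_eq_one_or s with rfl | rfl <;> simp [sgn]

theorem sgn_neg (s : ℤˣ) : sgn (-s) = -sgn s := by simp [sgn]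

theorem mul_sgn_mul_sgn (s : ℤˣ) (x y : ℝ) : sgn s * x * (sgn s * y) = x * y := by
  rcases Int.units_eq_one_or s with rfl | rfl <;> simp [sgn]

theorem neg_mem_signs {l : ℤˣ} (h : τ ∈ signs l) : -τ ∈ signs l := by
  simpa [signs] using h

theorem inv_mulVec_mulVec (y : Fin 2 → ℝ) : (P⁻¹).1.mulVec (P.1.mulVec y) = y := by
  rw [Matrix.mulVec_mulVec, ← Units.val_mul, inv_mul_cancel, Units.val_one, Matrix.one_mulVec]

theorem mulVec_inv_mulVec (y : Fin 2 → ℝ) : P.1.mulVec ((P⁻¹).1.mulVec y) = y := by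
  rw [Matrix.mulVec_mulVec, ← Units.val_mul, mul_inv_cancel, Units.val_one, Matrix.one_mulVec]

theorem mem_cone_iff {x : Fin 2 → ℝ} :
    x ∈ cone P A τ ↔ ∀ i, A i < sgn (τ i) * (P⁻¹).1.mulVec x i := by
  constructor
  · rintro ⟨y, hy, rfl⟩
    simpa only [inv_mulVec_mulVec, mem_ofPred_eq] using hy
  · exact fun h => ⟨_, h, mulVec_inv_mulVec x⟩

/-- The exponent `n` in the coordinates `k = Pᵀ n`. -/
def dualVec (P : Matrix.GeneralLinearGroup (Fin 2) ℝ) (n : Fin 2 → ℤ) : Fin 2 → ℝ :=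
  P.1.transpose.mulVec fun i => (n i : ℝ)

theorem dualVec_neg (n : Fin 2 → ℤ) : dualVec P (-n) = -dualVec P n := by
  simp only [dualVec, Pi.neg_apply, Int.cast_neg, ← Matrix.mulVec_neg]
  rfl

theorem sum_dualVec_mul (n : Fin 2 → ℤ) (x : Fin 2 → ℝ) :
    ∑ i, dualVec P n i * (P⁻¹).1.mulVec x i = ∑ i, n i * x i := by
  have h := Matrix.dotProduct_mulVec (fun i => (n i : ℝ)) P.1 ((P⁻¹).1.mulVec x)
  rw [← Matrix.mulVec_transpose, mulVec_inv_mulVec] at h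
  exact h.symm

theorem exists_norm_le_sum_abs_dualVec (P : Matrix.GeneralLinearGroup (Fin 2) ℝ) :
    ∃ c : ℝ, 0 < c ∧ ∀ n : Fin 2 → ℤ, ‖n‖ ≤ c * ∑ i, |dualVec P n i| := by
  have hker : P.1.transpose.mulVecLin.ker = ⊥ := LinearMap.ker_eq_bot.2 <|
    Matrix.mulVec_injective_of_isUnit (P.1.isUnit_transpose.2 P.isUnit)
  obtain ⟨K, hK, h⟩ := LinearMap.exists_antilipschitzWith _ hker
  refine ⟨K, hK, fun n => ?_⟩
  calc ‖n‖ = ‖fun i => (n i : ℝ)‖ := by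
        simp only [Pi.norm_def, nnnorm, Real.norm_eq_abs, ← Int.norm_eq_abs]
    _ ≤ K * ‖dualVec P n‖ := h.le_mul_norm (map_zero _) _
    _ ≤ K * ∑ i, |dualVec P n i| := by
        gcongr
        exact (pi_norm_le_iff_of_nonneg (by positivity)).2 fun i =>
          Finset.single_le_sum (fun j _ => abs_nonneg (dualVec P n j)) (Finset.mem_univ i)

theorem summable_exp_neg_mul_sum_abs_dualVec (P : Matrix.GeneralLinearGroup (Fin 2) ℝ) {ε : ℝ}
    (hε : 0 < ε) : Summable fun n : Fin 2 → ℤ => Real.exp (-(ε * ∑ i, |dualVec P n i|)) := by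
  obtain ⟨c, hc, h⟩ := exists_norm_le_sum_abs_dualVec P
  have htop : Tendsto (fun n : Fin 2 → ℤ => ‖n‖) cofinite atTop := by
    simpa only [cocompact_eq_cofinite] using tendsto_norm_cocompact_atTop (E := Fin 2 → ℤ)
  refine EisensteinSeries.summable_of_isBigO_rpow_norm (a := 3) (by norm_num) ?_
  refine .trans (.of_bound 1 (.of_forall fun n => ?_))
    (((isLittleO_exp_neg_mul_rpow_atTop (div_pos hε hc) (-3)).isBigO.comp_tendsto
      htop).congr_right fun n => Real.rpow_neg (norm_nonneg n) 3)
  rw [one_mul, Function.comp_apply, Real.norm_eq_abs, Real.norm_eq_abs, Real.abs_exp,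
    Real.abs_exp, Real.exp_le_exp, neg_mul, neg_le_neg_iff, div_mul_eq_mul_div, mul_div_assoc]
  exact mul_le_mul_of_nonneg_left ((div_le_iff₀' hc).2 (h n)) hε.le

/-- The exponents `n` for which `Pᵀ n` lies in the closed quadrant with signs `τ`. -/
def quadrant (P : Matrix.GeneralLinearGroup (Fin 2) ℝ) (τ : Fin 2 → ℤˣ) : Set (Fin 2 → ℤ) :=
  {n | ∀ i, 0 ≤ sgn (τ i) * dualVec P n i}

theorem neg_quadrant (τ : Fin 2 → ℤˣ) : -quadrant P τ = quadrant P (-τ) := by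
  ext n
  simp [quadrant, dualVec_neg, sgn_neg]

theorem dualVec_mul_eq (hn : n ∈ quadrant P τ) (i : Fin 2) (y : ℝ) :
    dualVec P n i * y = |dualVec P n i| * (sgn (τ i) * y) := by
  rw [← mul_sgn_mul_sgn (τ i), ← abs_of_nonneg (hn i), abs_mul, abs_sgn, one_mul]

/-- The weight `exp (-⟨a, |Pᵀ n|⟩)`; `coneWeight` is equal to it, for one of two values of `a`,
on each of `posExponents P` and its complement. -/
def expWeight (P : Matrix.GeneralLinearGroup (Fin 2) ℝ) (a : Fin 2 → ℝ) (n : Fin 2 → ℤ) : ℝ :=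
  Real.exp (-∑ i, a i * |dualVec P n i|)

theorem expWeight_pos (a : Fin 2 → ℝ) (n : Fin 2 → ℤ) : 0 < expWeight P a n := Real.exp_pos _

theorem expWeight_comp_neg (a : Fin 2 → ℝ) (n : Fin 2 → ℤ) :
    expWeight P a (-n) = expWeight P a n := by
  simp [expWeight, dualVec_neg]

theorem inv_expWeight (a : Fin 2 → ℝ) (n : Fin 2 → ℤ) :
    (expWeight P a n)⁻¹ = expWeight P (-a) n := by
  rw [expWeight, expWeight, ← Real.exp_neg]
  simp only [Pi.neg_apply, neg_mul, Finset.sum_neg_distrib]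

/-- The exponents `n` for which the coordinates of `Pᵀ n` have a nonnegative product. -/
def posExponents (P : Matrix.GeneralLinearGroup (Fin 2) ℝ) : Set (Fin 2 → ℤ) :=
  {n | 0 ≤ dualVec P n 0 * dualVec P n 1}

theorem coneWeight_of_mem (hn : n ∈ posExponents P) (a b : Fin 2 → ℝ) :
    (coneWeight P a b n : ℝ) = expWeight P a n :=
  congrArg (fun s : ℝ => Real.exp (-s)) <| Finset.sum_congr rfl fun i _ =>
    congrArg (· * |dualVec P n i|) (if_pos hn)

theorem coneWeight_of_notMem (hn : n ∈ (posExponents P)ᶜ) (a b : Fin 2 → ℝ) :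
    (coneWeight P a b n : ℝ) = expWeight P b n :=
  congrArg (fun s : ℝ => Real.exp (-s)) <| Finset.sum_congr rfl fun i _ =>
    congrArg (· * |dualVec P n i|) (if_neg hn)

theorem posExponents_subset : posExponents P ⊆ ⋃ τ ∈ signs 1, quadrant P τ := by
  intro n hn
  rw [mem_iUnion₂]
  have hnonneg : 0 ≤ dualVec P n 0 * dualVec P n 1 := hn
  rcases mul_nonneg_iff.1 hnonneg with ⟨h₀, h₁⟩ | ⟨h₀, h₁⟩
  · exact ⟨1, by simp [signs], Fin.forall_fin_two.2 (by simpa [sgn] using ⟨h₀, h₁⟩)⟩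
  · exact ⟨-1, by simp [signs], Fin.forall_fin_two.2 (by simpa [sgn] using ⟨h₀, h₁⟩)⟩

theorem compl_posExponents_subset : (posExponents P)ᶜ ⊆ ⋃ τ ∈ signs (-1), quadrant P τ := by
  intro n hn
  rw [mem_iUnion₂]
  have hneg : dualVec P n 0 * dualVec P n 1 < 0 := not_le.1 hn
  rcases mul_neg_iff.1 hneg with ⟨h₀, h₁⟩ | ⟨h₀, h₁⟩
  · exact ⟨![1, -1], by simp [signs],
      Fin.forall_fin_two.2 (by simpa [sgn] using ⟨h₀.le, h₁.le⟩)⟩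
  · exact ⟨![-1, 1], by simp [signs],
      Fin.forall_fin_two.2 (by simpa [sgn] using ⟨h₀.le, h₁.le⟩)⟩

end Exponents

section PointEvaluation

variable {P : Matrix.GeneralLinearGroup (Fin 2) ℝ} {A : Fin 2 → ℝ} {τ : Fin 2 → ℤˣ}
  {K : Set (Fin 2 → ℂ)}

theorem norm_prod_zpow {w : Fin 2 → ℂ} (hw : ∀ i, w i ≠ 0) (m : Fin 2 → ℤ) :
    ‖∏ i, w i ^ m i‖ = Real.exp (∑ i, m i * logAbs w i) := by
  rw [Real.exp_sum, norm_prod]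
  refine Finset.prod_congr rfl fun i _ => ?_
  rw [norm_zpow, logAbs, ← Real.log_zpow, Real.exp_log (zpow_pos (norm_pos_iff.2 (hw i)) _)]

theorem norm_prod_zpow_le {w : Fin 2 → ℂ} (hw : ∀ i, w i ≠ 0) {ε : ℝ}
    (hε : ∀ i, A i + ε ≤ sgn (τ i) * (P⁻¹).1.mulVec (logAbs w) i) {m : Fin 2 → ℤ}
    (hm : m ∈ quadrant P (-τ)) :
    ‖∏ i, w i ^ m i‖ ≤ Real.exp (-(ε * ∑ i, |dualVec P m i|)) * expWeight P A m := by
  rw [norm_prod_zpow hw, ← sum_dualVec_mul (P := P), expWeight, ← Real.exp_add, Real.exp_le_exp,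
    Finset.mul_sum, ← neg_add, ← Finset.sum_add_distrib, ← Finset.sum_neg_distrib]
  refine Finset.sum_le_sum fun i _ => ?_
  rw [dualVec_mul_eq hm, Pi.neg_apply, sgn_neg]
  linarith [mul_le_mul_of_nonneg_left (hε i) (abs_nonneg (dualVec P m i))]

theorem exists_add_le_of_isCompact (hK : IsCompact K) (hKD : K ⊆ domain P A τ) :
    ∃ ε : ℝ, 0 < ε ∧ ∀ w ∈ K, ∀ i, A i + ε ≤ sgn (τ i) * (P⁻¹).1.mulVec (logAbs w) i := by
  have hlog : ContinuousOn logAbs K := continuousOn_pi.2 fun i =>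
    ContinuousOn.log (by fun_prop) fun w hw => norm_ne_zero_iff.2 ((hKD hw).1 i)
  have hcont : ∀ i, ContinuousOn (fun w => sgn (τ i) * (P⁻¹).1.mulVec (logAbs w) i) K := fun i =>
    continuousOn_const.mul ((by fun_prop : Continuous fun x => (P⁻¹).1.mulVec x i).comp_continuousOn
      hlog)
  choose b hb hbK using fun i =>
    hK.exists_forall_le' (hcont i) fun w hw => mem_cone_iff.1 (hKD hw).2 i
  refine ⟨min (b 0 - A 0) (b 1 - A 1), lt_min (sub_pos.2 (hb 0)) (sub_pos.2 (hb 1)),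
    fun w hw => Fin.forall_fin_two.2 ⟨?_, ?_⟩⟩
  · linarith [hbK 0 w hw, min_le_left (b 0 - A 0) (b 1 - A 1)]
  · linarith [hbK 1 w hw, min_le_right (b 0 - A 0) (b 1 - A 1)]

theorem exists_sq_norm_sum_mul_prod_zpow_le (hK : IsCompact K) (hKD : K ⊆ domain P A τ) :
    ∃ C : ℝ, 0 ≤ C ∧ ∀ (f : (Fin 2 → ℤ) → ℂ) (S : Finset (Fin 2 → ℤ)), ↑S ⊆ quadrant P (-τ) →
      ∀ w ∈ K, ‖∑ m ∈ S, f m * ∏ i, w i ^ m i‖ ^ 2 ≤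
        C * ∑ m ∈ S, ‖f m‖ ^ 2 * expWeight P A m ^ 2 := by
  obtain ⟨ε, hε, hεK⟩ := exists_add_le_of_isCompact hK hKD
  let g (m : Fin 2 → ℤ) : ℝ := Real.exp (-(2 * ε * ∑ i, |dualVec P m i|))
  have hg : Summable g := summable_exp_neg_mul_sum_abs_dualVec P (mul_pos two_pos hε)
  refine ⟨∑' m, g m, tsum_nonneg fun _ => (Real.exp_pos _).le, fun f S hS w hw => ?_⟩
  have hterm : ∀ m ∈ S, ‖∏ i, w i ^ m i‖ ^ 2 * (expWeight P A m)⁻¹ ^ 2 ≤ g m := fun m hm => by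
    rw [← mul_pow, ← div_eq_mul_inv]
    calc (‖∏ i, w i ^ m i‖ / expWeight P A m) ^ 2
        ≤ Real.exp (-(ε * ∑ i, |dualVec P m i|)) ^ 2 := by
          have := expWeight_pos (P := P) A m
          gcongr
          exact (div_le_iff₀ this).2 (norm_prod_zpow_le (hKD hw).1 (hεK w hw) (hS hm))
      _ = g m := by rw [← Real.exp_nat_mul]; congr 1; push_cast; ring
  calc ‖∑ m ∈ S, f m * ∏ i, w i ^ m i‖ ^ 2
      ≤ (∑ m ∈ S, ‖f m‖ ^ 2 * expWeight P A m ^ 2) *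
          ∑ m ∈ S, ‖∏ i, w i ^ m i‖ ^ 2 * (expWeight P A m)⁻¹ ^ 2 :=
        sq_norm_sum_mul_le (fun m => (expWeight_pos A m).ne') f _ S
    _ ≤ (∑ m ∈ S, ‖f m‖ ^ 2 * expWeight P A m ^ 2) * ∑' m, g m := by
        gcongr
        exact (Finset.sum_le_sum hterm).trans (hg.sum_le_tsum S fun _ _ => (Real.exp_pos _).le)
    _ = _ := mul_comm _ _

end PointEvaluation

section CompositionMatrix

theorem differentiableOn_prod_zpow {ι E : Type*} [Fintype ι] [NormedAddCommGroup E]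
    [NormedSpace ℂ E] {F : E → ι → ℂ} {U : Set E} (hF : DifferentiableOn ℂ F U)
    (h0 : ∀ z ∈ U, ∀ i, F z i ≠ 0) (m : ι → ℤ) :
    DifferentiableOn ℂ (fun z => ∏ i, F z i ^ m i) U := by
  classical
  exact fun z hz => (HasFDerivWithinAt.finsetProd fun i _ =>
    ((differentiableAt_zpow.2 (Or.inl (h0 z hz i))).comp_differentiableWithinAt
      (g := fun w : ℂ => w ^ m i) z
      (differentiableOn_pi.1 hF i z hz)).hasFDerivWithinAt).differentiableWithinAt

theorem mFourierCoeff_sum_mul {ι κ : Type*} [Fintype ι] (S : Finset κ) (f : κ → ℂ)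
    {g : κ → UnitAddTorus ι → ℂ} (hg : ∀ m, Continuous (g m)) (n : ι → ℤ) :
    UnitAddTorus.mFourierCoeff (fun θ => ∑ m ∈ S, f m * g m θ) n =
      ∑ m ∈ S, f m * UnitAddTorus.mFourierCoeff (g m) n := by
  simp only [UnitAddTorus.mFourierCoeff, smul_eq_mul, Finset.mul_sum]
  rw [integral_finsetSum]
  · simp only [← integral_const_mul, mul_left_comm]
  · exact fun m _ => Continuous.integrable_of_hasCompactSupport
      ((ContinuousMap.continuous _).mul (continuous_const.mul (hg m))) (.of_compactSpace _)

theorem isCompact_polyTorus (ρ : Fin 2 → ℝ) : IsCompact (polyTorus ρ) := by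
  have h : polyTorus ρ = univ.pi fun i => sphere (0 : ℂ) (ρ i) := by
    ext z; simp [polyTorus]
  rw [h]
  exact isCompact_univ_pi fun i => isCompact_sphere _ _

theorem polyTorus_exp_subset_slab (v : Fin 2 → ℝ) :
    (polyTorus fun i => Real.exp (v i)) ⊆ slab v :=
  fun z hz => ⟨1, by simp, fun i => by rw [one_mul]; exact hz i⟩

theorem mem_slab_of_norm_eq_one {ι : Type*} (v : ι → ℝ) {z : ι → ℂ} (hz : ∀ i, ‖z i‖ = 1) :
    z ∈ slab v :=
  ⟨0, by simp, fun i => by simp [hz]⟩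

variable {P : Matrix.GeneralLinearGroup (Fin 2) ℝ} {A v : Fin 2 → ℝ} {τ : Fin 2 → ℤˣ}
  {F G : (Fin 2 → ℂ) → (Fin 2 → ℂ)} {J : (Fin 2 → ℂ) → ℂ} {U V : Set (Fin 2 → ℂ)}

theorem blockBound_laurentCoeff_mul_prod_zpow (hU : IsOpen U) (hv : slab v ⊆ U)
    (hF : DifferentiableOn ℂ F U) (hJ : DifferentiableOn ℂ J U) (h0 : ∀ z ∈ U, ∀ i, F z i ≠ 0)
    (hmaps : MapsTo F (polyTorus fun i => Real.exp (v i)) (domain P A τ)) :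
    BlockBound (fun m n => laurentCoeff (fun z => J z * ∏ i, F z i ^ m i) n)
      (expWeight P A) (fun n => Real.exp (∑ i, n i * v i)) (quadrant P (-τ)) univ := by
  have hK := isCompact_polyTorus fun i => Real.exp (v i)
  have hKU := (polyTorus_exp_subset_slab v).trans hv
  obtain ⟨C, hC, heval⟩ := exists_sq_norm_sum_mul_prod_zpow_le
    (hK.image_of_continuousOn (hF.continuousOn.mono hKU)) hmaps.image_subset
  obtain ⟨B, hB⟩ := hK.exists_bound_of_continuousOn (hJ.continuousOn.mono hKU)
  have hmon : ∀ m : Fin 2 → ℤ, DifferentiableOn ℂ (fun z => J z * ∏ i, F z i ^ m i) U :=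
    fun m => hJ.mul (differentiableOn_prod_zpow hF h0 m)
  refine ⟨B ^ 2 * C, by positivity, fun f S S' hS _ => ?_⟩
  let Φ (z : Fin 2 → ℂ) : ℂ := ∑ m ∈ S, f m * (J z * ∏ i, F z i ^ m i)
  have hΦ : DifferentiableOn ℂ Φ U := .fun_sum fun m _ => (hmon m).const_mul (f m)
  have hcoeff : ∀ n, laurentCoeff Φ n =
      ∑ m ∈ S, f m * laurentCoeff (fun z => J z * ∏ i, F z i ^ m i) n :=
    mFourierCoeff_sum_mul S f fun m => (hmon m).continuousOn.comp_continuous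
      continuous_torusPoint fun θ => hv (mem_slab_of_norm_eq_one v (norm_torusPoint θ))
  let N : ℝ := ∑ m ∈ S, ‖f m‖ ^ 2 * expWeight P A m ^ 2
  have hN : 0 ≤ B ^ 2 * C * N :=
    mul_nonneg (by positivity) (Finset.sum_nonneg fun _ _ => by positivity)
  have hsup : ∀ z, (∀ i, ‖z i‖ = Real.exp (v i)) → ‖Φ z‖ ≤ √(B ^ 2 * C * N) := fun z hz => by
    have hfactor : Φ z = J z * ∑ m ∈ S, f m * ∏ i, F z i ^ m i := by
      simp only [Φ, Finset.mul_sum, mul_left_comm]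
    refine Real.le_sqrt_of_sq_le ?_
    rw [hfactor, norm_mul, mul_pow, mul_assoc]
    gcongr
    exacts [hB z hz, heval f S hS _ (mem_image_of_mem F hz)]
  have hBessel := sum_sq_laurentCoeff_le hU hv hΦ hsup S'
  rw [Real.sq_sqrt hN] at hBessel
  simpa only [hcoeff, mul_pow] using hBessel

/-- The matrix of the composition operator `f ↦ f ∘ T` with respect to the monomials: the `m`-th
row consists of the Fourier coefficients of `T ^ m`. -/
def compMatrix (T : (Fin 2 → Circle) → (Fin 2 → Circle)) (m n : Fin 2 → ℤ) : ℂ :=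
  fourierCoefficient (fun z => ∏ i, (T z i : ℂ) ^ m i) n

theorem IsHolomorphicExtension.compMatrix_eq {T : (Fin 2 → Circle) → (Fin 2 → Circle)}
    (hF : IsHolomorphicExtension T F U) (m n : Fin 2 → ℤ) :
    compMatrix T m n = laurentCoeff (fun z => ∏ i, F z i ^ m i) n := by
  refine congrArg (UnitAddTorus.mFourierCoeff · n) (funext fun θ => ?_)
  exact Finset.prod_congr rfl fun i _ => congrArg (· ^ m i) (congr_fun (hF.2 _) i).symm

theorem IsHolomorphicExtension.slab_subset {T : (Fin 2 → Circle) → (Fin 2 → Circle)}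
    (hF : IsHolomorphicExtension T F U) (hU : IsOpen U) (hv : slab v ⊆ U) :
    slab v ⊆ U ∩ {z | ∀ i, F z i ≠ 0} := by
  refine subset_inter hv fun z hz i => ?_
  refine ne_zero_of_mem_slab hU hv (differentiableOn_pi.1 hF.1 i) (fun θ => ?_) hz
  exact (congrArg norm (congr_fun (hF.2 _) i)).trans (Circle.norm_coe _)

theorem IsHolomorphicExtension.blockBound_compMatrix {T : (Fin 2 → Circle) → (Fin 2 → Circle)}
    (hF : IsHolomorphicExtension T F U) (hU : IsOpen U) (hv : slab v ⊆ U)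
    (hmaps : MapsTo F (polyTorus fun i => Real.exp (v i)) (domain P A (-τ))) :
    BlockBound (compMatrix T) (expWeight P A) (fun n => Real.exp (∑ i, n i * v i))
      (quadrant P τ) univ := by
  have h := blockBound_laurentCoeff_mul_prod_zpow (J := 1)
    (isOpen_inter_forall_ne_zero hU hF.1.continuousOn) (hF.slab_subset hU hv)
    (hF.1.mono inter_subset_left) (differentiableOn_const 1) (fun z hz => hz.2) hmaps
  simpa only [Pi.one_apply, one_mul, neg_neg, ← hF.compMatrix_eq] using h

theorem exists_compMatrix_eq_laurentCoeff (T : (Fin 2 → Circle) ≃ (Fin 2 → Circle))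
    (hV : IsOpen V) (hG : IsHolomorphicExtension T.symm G V) (hGV : ∀ θ, torusPoint θ ∈ V)
    (hF : ∀ z, F (toC2 z) = toC2 (T z)) (hFd : ∀ θ, DifferentiableAt ℂ F (torusPoint θ)) :
    ∃ ε : ℂ, ∀ m n, compMatrix T m n =
      laurentCoeff (fun z => ε * (logJacobian G z).det * ∏ i, G z i ^ (-n) i) (-m) := by
  let e : UnitAddTorus (Fin 2) ≃ (Fin 2 → Circle) :=
    Equiv.piCongrRight fun _ => (AddCircle.homeomorphCircle (T := 1) one_ne_zero).toEquiv
  have he : ∀ θ, e θ = fun i => (θ i).toCircle := fun θ => funext fun i =>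
    AddCircle.homeomorphCircle_apply one_ne_zero (θ i)
  have hpt : ∀ θ, toC2 (e θ) = torusPoint θ := fun θ => congrArg toC2 (he θ)
  have hGe : ∀ θ, G (torusPoint θ) = torusPoint (e.symm (T.symm (e θ))) := fun θ => by
    rw [← hpt, ← hpt, e.apply_symm_apply, hG.2]
  obtain ⟨ε, -, h⟩ := exists_integral_eq_integral_det_logJacobian_mul (F := F)
    ((e.trans T.symm).trans e.symm) hV hG.1 hGV hGe hFd
    (fun θ => by rw [← hpt, hF, ← hpt]; simp)
  refine ⟨ε, fun m n => ?_⟩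
  calc compMatrix T m n
      = ∫ θ, UnitAddTorus.mFourier (-n) θ * ∏ i, toC2 (T (e θ)) i ^ m i := by
        simp only [he]
        rfl
    _ = laurentCoeff (fun z => ε * (logJacobian G z).det * ∏ i, G z i ^ (-n) i) (-m) := by
        rw [h, laurentCoeff, UnitAddTorus.mFourierCoeff]
        refine integral_congr_ae (.of_forall fun θ => ?_)
        simp only [Equiv.trans_apply, Equiv.apply_symm_apply, mFourier_apply, smul_eq_mul,
          neg_neg, hGe, hpt]
        ring

theorem IsHolomorphicExtension.blockBound_compMatrix_symm (T : (Fin 2 → Circle) ≃ (Fin 2 → Circle))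
    (hG : IsHolomorphicExtension T.symm G V) (hV : IsOpen V) (hv : slab v ⊆ V)
    (hF : ∀ z, F (toC2 z) = toC2 (T z)) (hFd : ∀ θ, DifferentiableAt ℂ F (torusPoint θ))
    (hmaps : MapsTo G (polyTorus fun i => Real.exp (v i)) (domain P A τ)) :
    BlockBound (compMatrix T) (fun m => Real.exp (∑ i, m i * v i)) (expWeight P (-A)) univ
      (quadrant P τ) := by
  have hV0 := isOpen_inter_forall_ne_zero hV hG.1.continuousOn
  have hG0 : DifferentiableOn ℂ G (V ∩ {z | ∀ i, G z i ≠ 0}) := hG.1.mono inter_subset_left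
  obtain ⟨ε, hε⟩ := exists_compMatrix_eq_laurentCoeff T hV hG
    (fun θ => hv (mem_slab_of_norm_eq_one v (norm_torusPoint θ))) hF hFd
  have h := (blockBound_laurentCoeff_mul_prod_zpow hV0 (hG.slab_subset hV hv) hG0
    ((differentiableOn_det_logJacobian hV0 hG0 fun z hz => hz.2).const_mul ε)
    (fun z hz => hz.2) hmaps).comp_neg
  refine BlockBound.of_transpose (fun _ => (Real.exp_pos _).ne') (fun _ => (Real.exp_pos _).ne') ?_
  simpa only [hε, neg_quadrant, neg_neg, Set.neg_univ, expWeight_comp_neg, inv_expWeight,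
    ← Real.exp_neg, Pi.neg_apply, Int.cast_neg, neg_mul, Finset.sum_neg_distrib] using h

end CompositionMatrix

section Annulus

variable {P : Matrix.GeneralLinearGroup (Fin 2) ℝ} {δ v : Fin 2 → ℝ} {σ : Fin 2 → ℤˣ}

theorem isOpen_annulus (P : Matrix.GeneralLinearGroup (Fin 2) ℝ) (δ : Fin 2 → ℝ) :
    IsOpen (annulus P δ) := by
  have hne : IsOpen {z : Fin 2 → ℂ | ∀ i, z i ≠ 0} := by
    simp only [ofPred_forall]
    exact isOpen_iInter_of_finite fun i => isOpen_ne.preimage (continuous_apply i)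
  have hlog : ContinuousOn logAbs {z : Fin 2 → ℂ | ∀ i, z i ≠ 0} :=
    continuousOn_pi.2 fun i => ContinuousOn.log (by fun_prop) fun w hw => norm_ne_zero_iff.2 (hw i)
  have hbox : IsOpen {x : Fin 2 → ℝ | ∀ i, |(P⁻¹).1.mulVec x i| < |δ i|} := by
    simp only [ofPred_forall]
    exact isOpen_iInter_of_finite fun i => isOpen_lt (by fun_prop) continuous_const
  exact hlog.isOpen_inter_preimage hne hbox

theorem mem_annulus_of_norm_eq {z : Fin 2 → ℂ} (hz : ∀ i, ‖z i‖ = Real.exp (v i))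
    (hv : ∀ i, |(P⁻¹).1.mulVec v i| < |δ i|) : z ∈ annulus P δ := by
  have hlog : logAbs z = v := funext fun i => by rw [logAbs, hz, Real.log_exp]
  refine ⟨fun i => ?_, by rwa [hlog]⟩
  rw [← norm_pos_iff, hz]
  exact Real.exp_pos _

theorem abs_inv_mulVec_smul (t : ℝ) (v : Fin 2 → ℝ) (i : Fin 2) :
    |(P⁻¹).1.mulVec (fun i => t * v i) i| = |t| * |(P⁻¹).1.mulVec v i| :=
  (congrArg (|· i|) ((P⁻¹).1.mulVec_smul t v)).trans (abs_mul _ _)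

theorem slab_subset_annulus (hv : ∀ i, |(P⁻¹).1.mulVec v i| < |δ i|) : slab v ⊆ annulus P δ := by
  rintro z ⟨t, ht, hz⟩
  refine mem_annulus_of_norm_eq hz fun i => ?_
  rw [abs_inv_mulVec_smul]
  exact (mul_le_of_le_one_left (abs_nonneg _) (abs_le.2 ht)).trans_lt (hv i)

theorem slab_subset_closure_annulus (hδ : ∀ i, δ i ≠ 0)
    (hv : ∀ i, |(P⁻¹).1.mulVec v i| ≤ |δ i|) : slab v ⊆ closure (annulus P δ) := by
  rintro z ⟨t, ht, hz⟩
  have hlim : Tendsto (fun s : ℝ => fun i => z i * Real.exp ((s - 1) * (t * v i)))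
      (𝓝[<] 1) (𝓝 z) := by
    refine (Continuous.tendsto' (by fun_prop) 1 z ?_).mono_left nhdsWithin_le_nhds
    ext i; simp
  refine mem_closure_of_tendsto hlim ?_
  filter_upwards [Ioo_mem_nhdsLT (zero_lt_one (α := ℝ))] with s hs
  refine mem_annulus_of_norm_eq (v := fun i => (s * t) * v i) (fun i => ?_) fun i => ?_
  · rw [norm_mul, hz, Complex.norm_real, Real.norm_eq_abs, Real.abs_exp, ← Real.exp_add]
    congr 1
    ring
  · have hst : |s * t| < 1 := by
      rw [abs_mul, abs_of_pos hs.1]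
      exact mul_lt_one_of_nonneg_of_lt_one_left hs.1.le hs.2 (abs_le.2 ht)
    rw [abs_inv_mulVec_smul]
    calc |s * t| * |(P⁻¹).1.mulVec v i| ≤ |s * t| * |δ i| :=
        mul_le_mul_of_nonneg_left (hv i) (abs_nonneg _)
      _ < |δ i| := mul_lt_of_lt_one_left (abs_pos.2 (hδ i)) hst

theorem abs_inv_mulVec_apex (δ : Fin 2 → ℝ) (σ : Fin 2 → ℤˣ) (i : Fin 2) :
    |(P⁻¹).1.mulVec (apex P δ σ) i| = |δ i| := by
  rw [apex, inv_mulVec_mulVec, abs_mul, abs_sgn, one_mul]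

theorem exists_slab_subset_annulus_of_polyTorus_subset {γ ρ : Fin 2 → ℝ} (hρ : ∀ i, 0 < ρ i)
    (h : polyTorus ρ ⊆ domain P γ σ ∩ annulus P δ) :
    ∃ v, (fun i => Real.exp (v i)) = ρ ∧ v ∈ cone P γ σ ∧ slab v ⊆ annulus P δ := by
  have hmem : (fun i => (ρ i : ℂ)) ∈ polyTorus ρ := fun i => by simpa using (hρ i).le
  exact ⟨logAbs fun i => ρ i, funext fun i => by simp [logAbs, Real.exp_log (hρ i)],
    (h hmem).1.2, slab_subset_annulus (h hmem).2.2⟩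

theorem abs_sum_mul_le (hv : ∀ i, |(P⁻¹).1.mulVec v i| ≤ δ i) (n : Fin 2 → ℤ) :
    |∑ i, n i * v i| ≤ ∑ i, δ i * |dualVec P n i| := by
  rw [← sum_dualVec_mul (P := P)]
  refine (Finset.abs_sum_le_sum_abs _ _).trans (Finset.sum_le_sum fun i _ => ?_)
  rw [abs_mul, mul_comm]
  exact mul_le_mul_of_nonneg_right (hv i) (abs_nonneg _)

theorem expWeight_le_exp_sum_mul (hv : ∀ i, |(P⁻¹).1.mulVec v i| ≤ δ i) (n : Fin 2 → ℤ) :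
    expWeight P δ n ≤ Real.exp (∑ i, n i * v i) :=
  Real.exp_le_exp.2 (abs_le.1 (abs_sum_mul_le hv n)).1

theorem exp_sum_mul_le_expWeight_neg (hv : ∀ i, |(P⁻¹).1.mulVec v i| ≤ δ i) (n : Fin 2 → ℤ) :
    Real.exp (∑ i, n i * v i) ≤ expWeight P (-δ) n := by
  refine Real.exp_le_exp.2 ((abs_le.1 (abs_sum_mul_le hv n)).2.trans_eq ?_)
  simp

theorem expWeight_neg_le_exp_of_mem_cone (hv : v ∈ cone P δ σ) {n : Fin 2 → ℤ}
    (hn : n ∈ quadrant P σ) : expWeight P (-δ) n ≤ Real.exp (∑ i, n i * v i) := by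
  rw [← sum_dualVec_mul (P := P), expWeight, Real.exp_le_exp, ← Finset.sum_neg_distrib]
  refine Finset.sum_le_sum fun i _ => ?_
  rw [dualVec_mul_eq hn, Pi.neg_apply, neg_mul, neg_neg, mul_comm]
  exact mul_le_mul_of_nonneg_left (mem_cone_iff.1 hv i).le (abs_nonneg _)

theorem StronglyExpanding.exists_mapsTo {l : ℤˣ} {Δ : Fin 2 → ℝ}
    {F : (Fin 2 → ℂ) → (Fin 2 → ℂ)} (h : StronglyExpanding l δ Δ P F) {τ : Fin 2 → ℤˣ}
    (hτ : τ ∈ signs l) : ∃ σ, MapsTo F (shilovTorus P δ σ) (domain P Δ τ) := by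
  rcases h.2 with h | h
  · exact ⟨τ, (h τ hτ).1⟩
  · exact ⟨-τ, by simpa only [neg_neg] using (h (-τ) (neg_mem_signs hτ)).1⟩

end Annulus

section SignBlocks

variable {P : Matrix.GeneralLinearGroup (Fin 2) ℝ} {α γ A Γ : Fin 2 → ℝ}
  {F G : (Fin 2 → ℂ) → (Fin 2 → ℂ)} {U V : Set (Fin 2 → ℂ)}

theorem IsHolomorphicExtension.blockBound_posExponents_univ
    {T : (Fin 2 → Circle) → (Fin 2 → Circle)} (hF : IsHolomorphicExtension T F U) (hU : IsOpen U)
    (hα : ∀ i, 0 ≤ α i) (hslab : ∀ σ, slab (apex P α σ) ⊆ U)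
    (hmaps : ∀ τ ∈ signs 1, ∃ σ, MapsTo F (shilovTorus P α σ) (domain P A τ)) :
    BlockBound (compMatrix T) (expWeight P A) (expWeight P α) (posExponents P) univ := by
  refine (BlockBound.biUnion_left (signs 1).toFinite fun τ hτ => ?_).mono
    posExponents_subset subset_rfl
  obtain ⟨σ, hσ⟩ := hmaps (-τ) (neg_mem_signs hτ)
  refine (hF.blockBound_compMatrix hU (hslab σ) hσ).mono_weight (fun _ _ => le_rfl) fun n _ =>
    abs_le_abs_of_nonneg (expWeight_pos _ _).le (expWeight_le_exp_sum_mul (fun i => ?_) n)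
  rw [abs_inv_mulVec_apex, abs_of_nonneg (hα i)]

theorem IsHolomorphicExtension.blockBound_posExponents_compl
    {T : (Fin 2 → Circle) → (Fin 2 → Circle)} (hF : IsHolomorphicExtension T F U) (hU : IsOpen U)
    (hmaps : ∀ τ ∈ signs 1, ∀ σ ∈ signs (-1), ∃ v ∈ cone P γ σ, slab v ⊆ U ∧
      MapsTo F (polyTorus fun i => Real.exp (v i)) (domain P A τ)) :
    BlockBound (compMatrix T) (expWeight P A) (expWeight P (-γ)) (posExponents P)
      (posExponents P)ᶜ := by
  refine (BlockBound.biUnion_left (signs 1).toFinite fun τ hτ =>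
    BlockBound.biUnion_right (signs (-1)).toFinite fun σ hσ => ?_).mono
    posExponents_subset compl_posExponents_subset
  obtain ⟨v, hvσ, hvU, hv⟩ := hmaps (-τ) (neg_mem_signs hτ) σ hσ
  exact ((hF.blockBound_compMatrix hU hvU hv).mono subset_rfl (subset_univ _)).mono_weight
    (fun _ _ => le_rfl) fun n hn =>
      abs_le_abs_of_nonneg (expWeight_pos _ _).le (expWeight_neg_le_exp_of_mem_cone hvσ hn)

theorem IsHolomorphicExtension.mapsTo_domain_neg {T : (Fin 2 → Circle) → (Fin 2 → Circle)}
    (hF : IsHolomorphicExtension T F U) (hΓ : ∀ i, 0 < Γ i) (τ : Fin 2 → ℤˣ) :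
    MapsTo F (polyTorus 1) (domain P (-Γ) τ) := by
  intro z hz
  obtain ⟨θ, rfl⟩ := exists_torusPoint_eq hz
  have hnorm : ∀ i, ‖F (torusPoint θ) i‖ = 1 := fun i =>
    (congrArg norm (congr_fun (hF.2 _) i)).trans (Circle.norm_coe _)
  have hlog : logAbs (F (torusPoint θ)) = 0 := funext fun i => by simp [logAbs, hnorm]
  refine ⟨fun i => norm_ne_zero_iff.1 (by simp [hnorm]), mem_cone_iff.2 fun i => ?_⟩
  simpa [hlog] using hΓ i

theorem IsHolomorphicExtension.blockBound_compl_posExponents_univ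
    {T : (Fin 2 → Circle) → (Fin 2 → Circle)} (hF : IsHolomorphicExtension T F U) (hU : IsOpen U)
    (h0 : slab 0 ⊆ U) (hα : ∀ i, 0 ≤ α i) (hΓ : ∀ i, 0 < Γ i) :
    BlockBound (compMatrix T) (expWeight P (-Γ)) (expWeight P α) (posExponents P)ᶜ univ := by
  refine (BlockBound.biUnion_left (signs (-1)).toFinite fun τ _ => ?_).mono
    compl_posExponents_subset subset_rfl
  have h1 : (fun i => Real.exp ((0 : Fin 2 → ℝ) i)) = 1 := funext fun _ => Real.exp_zero
  refine (hF.blockBound_compMatrix hU h0 (by rw [h1]; exact hF.mapsTo_domain_neg hΓ _)).mono_weight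
    (fun _ _ => le_rfl) fun n _ =>
      abs_le_abs_of_nonneg (expWeight_pos _ _).le (expWeight_le_exp_sum_mul (fun i => ?_) n)
  simpa using hα i

theorem IsHolomorphicExtension.blockBound_univ_compl_posExponents
    (T : (Fin 2 → Circle) ≃ (Fin 2 → Circle)) (hG : IsHolomorphicExtension T.symm G V)
    (hV : IsOpen V) (hΓ : ∀ i, 0 ≤ Γ i) (hslab : ∀ σ, slab (apex P Γ σ) ⊆ V)
    (hF : ∀ z, F (toC2 z) = toC2 (T z)) (hFd : ∀ θ, DifferentiableAt ℂ F (torusPoint θ))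
    (hmaps : ∀ τ ∈ signs (-1), ∃ σ, MapsTo G (shilovTorus P Γ σ) (domain P γ τ)) :
    BlockBound (compMatrix T) (expWeight P (-Γ)) (expWeight P (-γ)) univ (posExponents P)ᶜ := by
  refine (BlockBound.biUnion_right (signs (-1)).toFinite fun τ hτ => ?_).mono
    subset_rfl compl_posExponents_subset
  obtain ⟨σ, hσ⟩ := hmaps τ hτ
  refine (hG.blockBound_compMatrix_symm T hV (hslab σ) hF hFd hσ).mono_weight (fun m _ =>
    abs_le_abs_of_nonneg (Real.exp_pos _).le (exp_sum_mul_le_expWeight_neg (fun i => ?_) m))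
    fun _ _ => le_rfl
  rw [abs_inv_mulVec_apex, abs_of_nonneg (hΓ i)]

theorem blockBound_coneWeight {c : (Fin 2 → ℤ) → (Fin 2 → ℤ) → ℂ} {a b a' b' : Fin 2 → ℝ}
    (hpp : BlockBound c (expWeight P a) (expWeight P a') (posExponents P) (posExponents P))
    (hpn : BlockBound c (expWeight P a) (expWeight P b') (posExponents P) (posExponents P)ᶜ)
    (hnp : BlockBound c (expWeight P b) (expWeight P a') (posExponents P)ᶜ (posExponents P))
    (hnn : BlockBound c (expWeight P b) (expWeight P b') (posExponents P)ᶜ (posExponents P)ᶜ) :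
    BlockBound c (fun m => (coneWeight P a b m : ℝ)) (fun n => (coneWeight P a' b' n : ℝ))
      univ univ := by
  rw [← union_compl_self (posExponents P)]
  refine .union_left (.union_right (hpp.mono_weight ?_ ?_) (hpn.mono_weight ?_ ?_))
    (.union_right (hnp.mono_weight ?_ ?_) (hnn.mono_weight ?_ ?_)) <;>
    intro n hn <;> first
      | rw [coneWeight_of_mem hn]
      | rw [coneWeight_of_notMem hn]

end SignBlocks

section CompositionOperator

variable {ν ω : (Fin 2 → ℤ) → {x : ℝ // 0 < x}}

theorem Laurent.norm_sq_eq (f : Laurent ν) :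
    ‖f‖ ^ 2 = ∑ n ∈ f.finite_support.toFinset, ‖f.coeff n‖ ^ 2 * (ν n : ℝ) ^ 2 := by
  have h : weightedInner ν f f = (‖f‖ : ℂ) ^ 2 := inner_self_eq_norm_sq_to_K (𝕜 := ℂ) f
  rw [weightedInner_self] at h
  exact_mod_cast h.symm

theorem coeff_monomial (m n : Fin 2 → ℤ) : (monomial ν m).coeff n = if m = n then 1 else 0 := by
  classical
  exact Finsupp.single_apply

theorem inner_monomial_left (m : Fin 2 → ℤ) (f : Laurent ν) :
    inner ℂ (monomial ν m) f = f.coeff m * (ν m : ℝ) ^ 2 := by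
  have hsupp : Function.support (monomial ν m).coeff ⊆ (({m} : Finset (Fin 2 → ℤ)) : Set _) :=
    fun n hn => by
      rw [Finset.coe_singleton, mem_singleton_iff]
      by_contra hnm
      exact hn (by rw [coeff_monomial, if_neg (Ne.symm hnm)])
  refine (weightedInner_eq_sum ν _ f {m} hsupp).trans ?_
  simp [coeff_monomial]

theorem orthonormal_monomial : Orthonormal ℂ fun n : Fin 2 → ℤ =>
    ((ν n : ℝ)⁻¹ : ℂ) • ((monomial ν n : Laurent ν) : HardySpace ν) := by
  rw [orthonormal_iff_ite]
  intro m n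
  have hν : ((ν m : ℝ) : ℂ) ≠ 0 := Complex.ofReal_ne_zero.2 (ν m).2.ne'
  rw [inner_smul_left, inner_smul_right, UniformSpace.Completion.inner_coe, inner_monomial_left,
    coeff_monomial]
  obtain rfl | h := eq_or_ne m n
  · simp [field]
  · simp [h, h.symm]

theorem exists_represents {g : (Fin 2 → Circle) → ℂ} {B : ℝ} (hg : ∀ S : Finset (Fin 2 → ℤ),
      ∑ n ∈ S, ‖fourierCoefficient g n‖ ^ 2 * (ν n : ℝ) ^ 2 ≤ B) :
    ∃ h : HardySpace ν, Represents g h ∧ ‖h‖ ^ 2 ≤ B := by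
  have hO := (orthonormal_monomial (ν := ν)).orthogonalFamily
  let a (n : Fin 2 → ℤ) : ℂ := fourierCoefficient g n * (ν n : ℝ)
  have hterm : ∀ n, LinearIsometry.toSpanSingleton ℂ (HardySpace ν)
      ((orthonormal_monomial (ν := ν)).1 n) (a n) =
      fourierCoefficient g n • ((monomial ν n : Laurent ν) : HardySpace ν) := fun n => by
    have hν : ((ν n : ℝ) : ℂ) ≠ 0 := Complex.ofReal_ne_zero.2 (ν n).2.ne'
    rw [LinearIsometry.toSpanSingleton_apply, smul_smul, mul_inv_cancel_right₀ hν]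
  have hnorm : ∀ n, ‖a n‖ ^ 2 = ‖fourierCoefficient g n‖ ^ 2 * (ν n : ℝ) ^ 2 := fun n => by
    rw [norm_mul, mul_pow, Complex.norm_real, Real.norm_eq_abs, sq_abs]
  have hsum := (hO.summable_iff_norm_sq_summable a).2 <| by
    simpa only [hnorm] using summable_of_sum_le (fun n => by positivity) hg
  obtain ⟨h, hh⟩ := hsum
  simp only [hterm] at hh
  refine ⟨h, hh, le_of_tendsto ((continuous_norm.pow 2).tendsto h |>.comp hh)
    (.of_forall fun S => ?_)⟩
  have hS := hO.norm_sum a S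
  simp only [hterm, hnorm] at hS
  exact hS.trans_le (hg S)

theorem Represents.unique {g : (Fin 2 → Circle) → ℂ} {h₁ h₂ : HardySpace ν}
    (H₁ : Represents g h₁) (H₂ : Represents g h₂) : h₁ = h₂ := HasSum.unique H₁ H₂

theorem Laurent.toFun_eq_sum (f : Laurent ν) (z : Fin 2 → Circle) :
    f.toFun z = ∑ n ∈ f.finite_support.toFinset, f.coeff n * ∏ i, (z i : ℂ) ^ n i := by
  refine finsum_eq_sum_of_support_subset _ fun n hn => ?_
  simp only [Finite.coe_toFinset, Function.mem_support] at hn ⊢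
  exact left_ne_zero_of_mul hn

theorem IsHolomorphicExtension.continuous {T : (Fin 2 → Circle) → (Fin 2 → Circle)}
    {F : (Fin 2 → ℂ) → (Fin 2 → ℂ)} {U : Set (Fin 2 → ℂ)} (hF : IsHolomorphicExtension T F U)
    (hU : ∀ z, toC2 z ∈ U) : Continuous T := by
  have hC2 : Continuous toC2 :=
    continuous_pi fun i => continuous_subtype_val.comp (continuous_apply i)
  have h : Continuous fun z => F (toC2 z) := hF.1.continuousOn.comp_continuous hC2 hU
  simp only [hF.2] at h
  exact continuous_pi fun i =>
    Topology.IsEmbedding.subtypeVal.continuous_iff.2 ((continuous_apply i).comp h)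

variable {T : (Fin 2 → Circle) → (Fin 2 → Circle)}

theorem fourierCoefficient_toFun_comp (hT : Continuous T) (f : Laurent ν) (n : Fin 2 → ℤ) :
    fourierCoefficient (fun z => f.toFun (T z)) n =
      ∑ m ∈ f.finite_support.toFinset, f.coeff m * compMatrix T m n := by
  simp only [Laurent.toFun_eq_sum]
  refine mFourierCoeff_sum_mul _ f.coeff (fun m => continuous_finsetProd _ fun i _ => ?_) n
  refine Continuous.zpow₀ ?_ _ fun z => Or.inl (Circle.coe_ne_zero _)
  exact continuous_subtype_val.comp ((continuous_apply i).comp (hT.comp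
    (continuous_pi fun j => AddCircle.continuous_toCircle.comp (continuous_apply j))))

theorem exists_linearMap_represents_comp (hT : Continuous T)
    (hcol : ∀ m : Fin 2 → ℤ, ∃ h : HardySpace ω,
      Represents (fun z => ∏ i, (T z i : ℂ) ^ m i) h) :
    ∃ L : Laurent ν →ₗ[ℂ] HardySpace ω, ∀ f : Laurent ν,
      Represents (fun z => f.toFun (T z)) (L f) := by
  choose h hh using hcol
  refine ⟨⟨⟨Finsupp.linearCombination ℂ h, map_add (Finsupp.linearCombination ℂ h)⟩,
    map_smul (Finsupp.linearCombination ℂ h)⟩, fun f => ?_⟩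
  have hsum : HasSum (fun n => ∑ m ∈ f.finite_support.toFinset, f.coeff m •
      compMatrix T m n • ((monomial ω n : Laurent ω) : HardySpace ω))
      (∑ m ∈ f.finite_support.toFinset, f.coeff m • h m) :=
    hasSum_sum fun m _ => (hh m).const_smul (f.coeff m)
  have hL : Finsupp.linearCombination ℂ h (show (Fin 2 → ℤ) →₀ ℂ from f) =
      ∑ m ∈ f.finite_support.toFinset, f.coeff m • h m :=
    Finset.sum_congr (by ext m; rw [Finite.mem_toFinset]; exact Finsupp.mem_support_iff)
      fun _ _ => rfl
  refine (hL ▸ hsum).congr_fun fun n => ?_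
  rw [fourierCoefficient_toFun_comp hT, Finset.sum_smul]
  simp only [mul_smul]

theorem existsUnique_completion_extend {𝕜 E H : Type*} [RCLike 𝕜] [NormedAddCommGroup E]
    [NormedSpace 𝕜 E] [NormedAddCommGroup H] [NormedSpace 𝕜 H] [CompleteSpace H] (L : E →ₗ[𝕜] H)
    {C : ℝ} (hL : ∀ x, ‖L x‖ ≤ C * ‖x‖) :
    ∃! L' : UniformSpace.Completion E →L[𝕜] H, ∀ x : E, L' x = L x := by
  have hdense : DenseRange (UniformSpace.Completion.toComplL (𝕜 := 𝕜) (E := E)) :=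
    UniformSpace.Completion.denseRange_coe
  have hind := UniformSpace.Completion.isUniformInducing_coe E
  refine ⟨(L.mkContinuous C hL).extend UniformSpace.Completion.toComplL, fun x =>
    (L.mkContinuous C hL).extend_eq hdense hind x, fun L' h => ?_⟩
  exact ((L.mkContinuous C hL).extend_unique hdense hind L' (ContinuousLinearMap.ext h)).symm

theorem existsUnique_represents_comp (hT : Continuous T)
    (h : BlockBound (compMatrix T) (fun m => (ν m : ℝ)) (fun n => (ω n : ℝ)) univ univ) :
    ∃! L : HardySpace ν →L[ℂ] HardySpace ω, ∀ f : Laurent ν,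
      Represents (fun z => f.toFun (T z)) (L (f : HardySpace ν)) := by
  obtain ⟨C, hC, h⟩ := h
  have hcol : ∀ (m : Fin 2 → ℤ) (S : Finset (Fin 2 → ℤ)),
      ∑ n ∈ S, ‖compMatrix T m n‖ ^ 2 * (ω n : ℝ) ^ 2 ≤ C * (ν m : ℝ) ^ 2 := fun m S => by
    simpa using h 1 {m} S (subset_univ _) (subset_univ _)
  obtain ⟨L, hL⟩ := exists_linearMap_represents_comp (ν := ν) (ω := ω) hT fun m =>
    (exists_represents (hcol m)).imp fun _ => And.left
  have hbound : ∀ f, ‖L f‖ ≤ √C * ‖f‖ := fun f => by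
    obtain ⟨g, hg, hgC⟩ := exists_represents (ν := ω) (g := fun z => f.toFun (T z))
      (B := C * ‖f‖ ^ 2) fun S => by
        rw [Laurent.norm_sq_eq]
        simpa only [fourierCoefficient_toFun_comp hT] using
          h f.coeff f.finite_support.toFinset S (subset_univ _) (subset_univ _)
    rw [(hL f).unique hg, ← Real.sqrt_sq (norm_nonneg f), ← Real.sqrt_mul hC]
    exact Real.le_sqrt_of_sq_le hgC
  have hiff : ∀ L' : HardySpace ν →L[ℂ] HardySpace ω, (∀ f : Laurent ν,
      Represents (fun z => f.toFun (T z)) (L' (f : HardySpace ν))) ↔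
      ∀ f : Laurent ν, L' (f : HardySpace ν) = L f := fun L' =>
    forall_congr' fun f => ⟨fun hf => hf.unique (hL f), fun hf => hf ▸ hL f⟩
  simpa only [hiff] using existsUnique_completion_extend L hbound

end CompositionOperator

end TorusHardy

end

open TorusHardy in
theorem theorem3_general (T : (Fin 2 → Circle) ≃ (Fin 2 → Circle))
    (P : Matrix.GeneralLinearGroup (Fin 2) ℝ) (α γ A Γ η : Fin 2 → ℝ)
    (hα : ∀ i, 0 ≤ α i) (hΓ : ∀ i, 0 < Γ i) (hαη : ∀ i, α i < η i)
    (F G : (Fin 2 → ℂ) → (Fin 2 → ℂ)) (hF : IsHolomorphicExtension T F (annulus P η))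
    (V : Set (Fin 2 → ℂ)) (hV : IsOpen V) (hΓV : closure (annulus P Γ) ⊆ V)
    (hG : IsHolomorphicExtension T.symm G V)
    (hT : ∀ τ ∈ signs 1, ∃ σ, Set.MapsTo F (shilovTorus P α σ) (domain P A τ))
    (hTinv : ∀ τ ∈ signs (-1), ∃ σ, Set.MapsTo G (shilovTorus P Γ σ) (domain P γ τ))
    (htorus : ∀ τ ∈ signs 1, ∀ σ ∈ signs (-1), ∃ ρ : Fin 2 → ℝ, (∀ i, 0 < ρ i) ∧
      polyTorus ρ ⊆ domain P γ σ ∩ annulus P η ∧ Set.MapsTo F (polyTorus ρ) (domain P A τ)) :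
    ∃! L : HardySpace (coneWeight P A (-Γ)) →L[ℂ] HardySpace (coneWeight P α (-γ)),
      ∀ f : Laurent (coneWeight P A (-Γ)),
        Represents (fun z => f.toFun (T z)) (L (f : HardySpace (coneWeight P A (-Γ)))) := by
  have hα_slab : ∀ σ, slab (apex P α σ) ⊆ annulus P η := fun σ =>
    slab_subset_annulus fun i => by
      rw [abs_inv_mulVec_apex, abs_of_nonneg (hα i)]
      exact (hαη i).trans_le (le_abs_self _)
  have hΓ_slab : ∀ σ, slab (apex P Γ σ) ⊆ V := fun σ =>
    (slab_subset_closure_annulus (fun i => (hΓ i).ne') fun i =>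
      (abs_inv_mulVec_apex Γ σ i).le).trans hΓV
  have h0_slab : slab 0 ⊆ annulus P η :=
    slab_subset_annulus fun i => by simpa using ((hα i).trans_lt (hαη i)).ne'
  have hmaps : ∀ τ ∈ signs 1, ∀ σ ∈ signs (-1), ∃ v ∈ cone P γ σ, slab v ⊆ annulus P η ∧
      Set.MapsTo F (polyTorus fun i => Real.exp (v i)) (domain P A τ) := fun τ hτ σ hσ => by
    obtain ⟨ρ, hρ, hρσ, hρF⟩ := htorus τ hτ σ hσ
    obtain ⟨v, rfl, hvσ, hvη⟩ := exists_slab_subset_annulus_of_polyTorus_subset hρ hρσ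
    exact ⟨v, hvσ, hvη, hρF⟩
  have hU := isOpen_annulus P η
  have hF_diff : ∀ θ, DifferentiableAt ℂ F (torusPoint θ) := fun θ =>
    hF.1.differentiableAt (hU.mem_nhds (h0_slab (mem_slab_of_norm_eq_one 0 (norm_torusPoint θ))))
  have hT_cont : Continuous T := hF.continuous fun z =>
    h0_slab (mem_slab_of_norm_eq_one 0 fun i => Circle.norm_coe (z i))
  refine existsUnique_represents_comp hT_cont (blockBound_coneWeight ?_ ?_ ?_ ?_)
  · exact (hF.blockBound_posExponents_univ hU hα hα_slab hT).mono subset_rfl (Set.subset_univ _)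
  · exact hF.blockBound_posExponents_compl hU hmaps
  · exact (hF.blockBound_compl_posExponents_univ hU h0_slab hα hΓ).mono subset_rfl
      (Set.subset_univ _)
  · exact (hG.blockBound_univ_compl_posExponents T hV (fun i => (hΓ i).le) hΓ_slab hF.2 hF_diff
      hTinv).mono (Set.subset_univ _) subset_rfl

open TorusHardy in
/-- The diffeomorphism of the unit torus is the bijection `T`; it and its inverse are analytic
because they have the holomorphic extensions `F` and `G`. -/
theorem theorem3
    (T : (Fin 2 → Circle) ≃ (Fin 2 → Circle))
    (P : Matrix.GeneralLinearGroup (Fin 2) ℝ)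
    (α γ A Γ η : Fin 2 → ℝ)
    (hα : ∀ i, 0 < α i) (hγ : ∀ i, 0 < γ i) (hA : ∀ i, 0 < A i) (hΓ : ∀ i, 0 < Γ i)
    (hη : ∀ i, 0 < η i) (hαη : ∀ i, α i < η i) (hγη : ∀ i, γ i < η i)
    (F G : (Fin 2 → ℂ) → (Fin 2 → ℂ))
    (hF : IsHolomorphicExtension T F (annulus P η))
    (hG : IsHolomorphicExtension T.symm G (annulus P η))
    (hT : StronglyExpanding 1 α A P F)
    (hTinv : StronglyExpanding (-1) Γ γ P G)
    (htorus : ∀ τ ∈ signs 1, ∀ σ ∈ signs (-1), ∃ ρ : Fin 2 → ℝ, (∀ i, 0 < ρ i) ∧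
      polyTorus ρ ⊆ domain P γ σ ∩ annulus P η ∧ Set.MapsTo F (polyTorus ρ) (domain P A τ)) :
    ∃! L : HardySpace (coneWeight P A (-Γ)) →L[ℂ] HardySpace (coneWeight P α (-γ)),
      ∀ f : Laurent (coneWeight P A (-Γ)),
        Represents (fun z => f.toFun (T z)) (L (f : HardySpace (coneWeight P A (-Γ)))) := by
  obtain ⟨V, hV, hΓV, hGV⟩ := hTinv.1
  exact theorem3_general T P α γ A Γ η (fun i => (hα i).le) hΓ hαη F G hF V hV hΓV ⟨hGV, hG.2⟩
    (fun _ => hT.exists_mapsTo) (fun _ => hTinv.exists_mapsTo) htorus
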